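/- Notation. Let $n\ge 1$, let $\mathbb{B}^n$ be the open Euclidean unit ball of $\mathbb{C}^n$ with $\langle z,w\rangle=\sum_j z_j\overline{w_j}$, $\|z\|=\sqrt{\langle z,z\rangle}$, let $\mathbb{D}$ be the unit disc, and let $J_f(z)$ be the complex Jacobian matrix of $f$ at $z$. For a holomorphic function $g$ on $\mathbb{D}$, $\alpha\in[0,1)$ and $\beta\in(-\frac{\pi}{2},\frac{\pi}{2})$, let $\widetilde{\mathcal M}_g^{\alpha,\beta}$ be the set of holomorphic $h:\mathbb{B}^n\to\mathbb{C}^n$ with $h(0)=0$, $J_h(0)=I_n$ and $$\frac{-\alpha+i\tan\beta}{1-\alpha}+\frac{1-i\tan\beta}{1-\alpha}\Big\langle h(z),\frac{z}{\|z\|^2}\Big\rangle\in g(\mathbb{D})\qquad(z\in\mathbb{B}^n\setminus\{0\}),$$ and let $\widehat{\mathcal S}_g^{\alpha,\beta}(\mathbb{B}^n)$ be the set of holomorphic $f:\mathbb{B}^n\to\mathbb{C}^n$ with $f(0)=0$, $J_f(0)=I_n$, $\det J_f(z)\ne0$ for all $z\in\mathbb{B}^n$, and such that $z\mapsto[J_f(z)]^{-1}f(z)$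 belongs to $\widetilde{\mathcal M}_g^{\alpha,\beta}$. Theorem 3.4. Let $-1\le A<B\le1$, $\alpha\in[0,1)$, $\beta\in(-\frac{\pi}{2},\frac{\pi}{2})$, $g(\zeta)=\frac{1+A\zeta}{1+B\zeta}$ for $\zeta\in\mathbb{D}$, and $f\in\widehat{\mathcal S}_g^{\alpha,\beta}(\mathbb{B}^n)$. For $z\in\mathbb{B}^n\setminus\{0\}$ put $T=A-A\alpha+B\alpha$, $$F_1=\Big(\frac{1+A\|z\|}{1+B\|z\|}-\frac{\sqrt{\alpha^2+\tan^2\beta}}{1-\alpha}\Big)(1-\alpha)\cos\beta,\qquad F_2=\Big(\frac{1-A\|z\|}{1-B\|z\|}+\frac{\sqrt{\alpha^2+\tan^2\beta}}{1-\alpha}\Big)(1-\alpha)\cos\beta .$$ (1) If $\|f(z)\|=\max_{\|\xi\|=\|z\|}\|f(\xi)\|$ and $F_1>0$, then $$|\det J_f(z)|\le\begin{cases}(1+T\|z\|)^{\frac{n(B-A)(1-\alpha)}{T}}\,F_1^{-\frac{n+1}{2}},&T\ne0,\\ e^{n(B-A)(1-\alpha)\|z\|}\,F_1^{-\frac{n+1}{2}},&T=0,\end{cases}$$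 and, for every $\delta\in\mathbb{C}^n$ with $\langle\delta,z\rangle=0$ (that is, $\delta$ in the holomorphic tangent space at $z$ of the sphere of radius $\|z\|$), $$\|J_f(z)\delta\|\le\begin{cases}(1+T\|z\|)^{\frac{(B-A)(1-\alpha)}{T}}\,F_1^{-\frac12}\|\delta\|,&T\ne0,\\ e^{(B-A)(1-\alpha)\|z\|}\,F_1^{-\frac12}\|\delta\|,&T=0.\end{cases}$$ (2) If $\|f(z)\|=\min_{\|\xi\|=\|z\|}\|f(\xi)\|$, then $$|\det J_f(z)|\ge\begin{cases}(1-T\|z\|)^{\frac{n(B-A)(1-\alpha)}{T}}\,F_2^{-\frac{n+1}{2}},&T\ne0,\\ e^{-n(B-A)(1-\alpha)\|z\|}\,F_2^{-\frac{n+1}{2}},&T=0,\end{cases}$$ and, for every $\delta\in\mathbb{C}^n$ with $\langle\delta,z\rangle=0$, $$\|J_f(z)\delta\|\ge\begin{cases}(1-T\|z\|)^{\frac{(B-A)(1-\alpha)}{T}}\,F_2^{-\frac12}\|\delta\|,&T\ne0,\\ e^{-(B-A)(1-\alpha)\|z\|}\,F_2^{-\frac12}\|\delta\|,&T=0.\end{cases}$$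 -/

import Mathlib

/-- `LS(𝔹ⁿ)`: normalized locally biholomorphic mappings on the Euclidean unit ball of `ℂⁿ`.
The complex Jacobian `J_f(z)` is the complex Fréchet derivative `fderiv ℂ f z`, i.e. the linear map
with matrix `(∂f_i/∂z_j (z))` in the standard basis. Mappings are total functions, but only their
values on the open unit ball matter. -/
structure IsNormalizedLocBihol {n : ℕ}
    (f : EuclideanSpace ℂ (Fin n) → EuclideanSpace ℂ (Fin n)) : Prop where
  holo : DifferentiableOn ℂ f (Metric.ball 0 1)
  map_zero : f 0 = 0
  deriv_zero : fderiv ℂ f 0 = ContinuousLinearMap.id ℂ (EuclideanSpace ℂ (Fin n))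
  det_ne_zero : ∀ z ∈ Metric.ball (0 : EuclideanSpace ℂ (Fin n)) 1, (fderiv ℂ f z).det ≠ 0

/-- The Carathéodory-type class `M̃_g^{α,β}` on the unit ball. The Hermitian product `⟨h(z), z⟩`
that is linear in its first argument is `inner ℂ z (h z)` in Mathlib's convention. -/
structure IsMTilde {n : ℕ} (g : ℂ → ℂ) (α β : ℝ)
    (h : EuclideanSpace ℂ (Fin n) → EuclideanSpace ℂ (Fin n)) : Prop where
  holo : DifferentiableOn ℂ h (Metric.ball 0 1)
  map_zero : h 0 = 0
  deriv_zero : fderiv ℂ h 0 = ContinuousLinearMap.id ℂ (EuclideanSpace ℂ (Fin n))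
  mem_image : ∀ z ∈ Metric.ball (0 : EuclideanSpace ℂ (Fin n)) 1, z ≠ 0 →
    (-(α : ℂ) + Complex.I * (Real.tan β : ℂ)) / (1 - (α : ℂ))
      + (1 - Complex.I * (Real.tan β : ℂ)) / (1 - (α : ℂ))
        * (inner ℂ z (h z) / ((‖z‖ : ℂ) ^ 2)) ∈ g '' Metric.ball (0 : ℂ) 1

/-- The class `Ŝ_g^{α,β}(𝔹ⁿ)`: those `f ∈ LS(𝔹ⁿ)` for which `z ↦ J_f(z)⁻¹ f(z)` lies in
`M̃_g^{α,β}`. -/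
def SHat (n : ℕ) (g : ℂ → ℂ) (α β : ℝ) :
    Set (EuclideanSpace ℂ (Fin n) → EuclideanSpace ℂ (Fin n)) :=
  {f | IsNormalizedLocBihol f ∧ IsMTilde g α β (fun z => (fderiv ℂ f z).inverse (f z))}

/-- The function `ζ ↦ (1 + Aζ) / (1 + Bζ)`. -/
noncomputable def gAB (A B : ℝ) : ℂ → ℂ :=
  fun ζ => (1 + (A : ℂ) * ζ) / (1 + (B : ℂ) * ζ)

/-- The holomorphic tangent space at `z` to the sphere of radius `‖z‖`:
all `w` with `conj(z)ᵀ w = 0`. -/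
def holoTangent {n : ℕ} (z : EuclideanSpace ℂ (Fin n)) : Set (EuclideanSpace ℂ (Fin n)) :=
  {w | inner ℂ z w = 0}

/-- The quantity `T = A - Aα + Bα`. -/
def paramT (A B α : ℝ) : ℝ := A - A * α + B * α

/-- The quantity `F₁` at radius `r`. -/
noncomputable def quantF₁ (A B α β r : ℝ) : ℝ :=
  ((1 + A * r) / (1 + B * r) - 1 / (1 - α) * Real.sqrt (α ^ 2 + Real.tan β ^ 2))
    * (1 - α) * Real.cos β

/-- The quantity `F₂` at radius `r`. -/
noncomputable def quantF₂ (A B α β r : ℝ) : ℝ :=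
  ((1 - A * r) / (1 - B * r) + 1 / (1 - α) * Real.sqrt (α ^ 2 + Real.tan β ^ 2))
    * (1 - α) * Real.cos β

/-!
Let `h(z) = J_f(z)⁻¹ f(z)`, `r = ‖z‖` and `p(z) = ⟨h(z), z⟩ / r²`. The proof rests on the behaviour
of `f` at the points `z` where `‖f‖` is extremal on the sphere of radius `r`.

At such a point the first derivatives of `‖f‖²` along the sphere vanish, so `J_f(z)` maps the
orthogonal complement of `z` into that of `f(z)`, and `⟨J_f(z) z, f(z)⟩` is real. Writing
`f(z) = J_f(z) h(z)` gives `‖f(z)‖² = p(z) ⟨J_f(z) z, f(z)⟩`; in particular `p(z)` is *real*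
(`norm_sq_eq_of_isExtrOn_sphere`). The second derivatives along the sphere in the directions `v` and
`i v` add up to the Levi form, from which the second derivatives of `f` cancel. At a maximum this
gives `‖J_f(z) v‖² ≤ ‖f(z)‖² ‖v‖² / (p(z) r²)` for `v ⊥ z`, and the reverse at a minimum
(`norm_fderiv_sq_le_of_isMaxOn_sphere`, `le_norm_fderiv_sq_of_isMinOn_sphere`).

By the Schwarz lemma the value `G` which the definition of the class attaches to `p(z)` satisfies
`‖1 - G‖ ≤ r ‖B G - A‖`. A real `p` subject to this inequality lies between
`(1 + T r) / (1 + B r)` and `(1 - T r) / (1 - B r)` whatever `β` is (`real_value_bounds`); for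
complex `p` the corresponding bounds on the modulus would depend on `β`. The triangle inequality
adds `p ≤ F₂`, while `F₁ ≤ (1 + T r) / (1 + B r) ≤ p`.

The growth bounds come out of the same extremal points. The function
`log (‖f(z)‖ / ‖z‖) - e(‖z‖)`, where `e` is a primitive of `(B - A)(1 - α) / (1 + T r)`, vanishes at
the origin, and at each maximum on a sphere its radial derivative is nonpositive, because
`1 / p ≤ (1 + B r) / (1 + T r)` there. Such a function is nonpositive
(`nonpos_of_radial_deriv_nonpos`). The lower bound is symmetric.

The tangential bounds follow at once. For the determinant, `J_f(z)` is changed on the line `ℂ z`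
alone so that all vectors are stretched by at most (at least) the factor `c = ‖f(z)‖ / (√p r)`. This
multiplies the determinant by `√p`, and the modified determinant is compared with `cⁿ` through its
eigenvalues (`norm_det_mul_sqrt_le`, `le_norm_det_mul_sqrt`).
-/

/-! ### First-order conditions at an extremum on a sphere -/

section FirstOrder

open Filter Topology Metric Set Asymptotics
variable {E : Type*} [NormedAddCommGroup E] [InnerProductSpace ℂ E]

/-- A holomorphic map is `C¹`: Cauchy's estimate, in the form of the Schwarz lemma, turns the bound
`o(‖x - z‖)` on the first-order remainder at `z` into continuity of the derivative at `z`. -/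
theorem DifferentiableOn.hasStrictFDerivAt_of_complex {F : Type*} [NormedAddCommGroup F]
    [NormedSpace ℂ F] {f : E → F} {U : Set E} (hf : DifferentiableOn ℂ f U) (hU : IsOpen U)
    {z : E} (hz : z ∈ U) : HasStrictFDerivAt f (fderiv ℂ f z) z := by
  have hd : ∀ᶠ y in 𝓝 z, HasFDerivAt f (fderiv ℂ f y) y := by
    filter_upwards [hU.mem_nhds hz] with y hy
    exact (hf.differentiableAt (hU.mem_nhds hy)).hasFDerivAt
  refine hasStrictFDerivAt_of_hasFDerivAt_of_continuousAt hd ?_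
  set J := fderiv ℂ f z with hJ
  have ho : (fun y => f y - f z - J (y - z)) =o[𝓝 z] fun y => y - z :=
    (hf.differentiableAt (hU.mem_nhds hz)).hasFDerivAt.isLittleO
  rw [Metric.continuousAt_iff]
  intro ε hε
  have h1 := ho.def (show 0 < ε / 16 by positivity)
  obtain ⟨ρ, hρ, hball⟩ := Metric.eventually_nhds_iff_ball.1 (h1.and (hU.eventually_mem hz))
  refine ⟨ρ / 4, by positivity, fun {y} hy => ?_⟩
  -- `k` is the first-order Taylor remainder of `f` at `z`; Cauchy's estimate on the ball of
  -- radius `ρ / 4` about `y` bounds its derivative there.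
  let k : E → F := fun x => f x - f z - J (x - z)
  have hyd : DifferentiableAt ℂ f y := by
    refine hf.differentiableAt (hU.mem_nhds (hball y ?_).2)
    rw [mem_ball]; linarith
  have hkf : fderiv ℂ k y = fderiv ℂ f y - J := by
    have : HasFDerivAt k (fderiv ℂ f y - J) y := by
      have := (hyd.hasFDerivAt.sub_const (f z)).sub
        (J.hasFDerivAt.comp y ((hasFDerivAt_id y).sub_const z))
      exact this
    exact this.fderiv
  have hsub : ball y (ρ / 4) ⊆ ball z (ρ / 2) := by
    intro x hx
    rw [mem_ball] at *
    linarith [dist_triangle x y z]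
  have hkb : ∀ x ∈ ball z (ρ / 2), ‖k x‖ ≤ ε / 16 * (ρ / 2) := by
    intro x hx
    have h2 := (hball x (ball_subset_ball (by linarith) hx)).1
    rw [mem_ball, dist_eq_norm] at hx
    calc ‖k x‖ ≤ ε / 16 * ‖x - z‖ := h2
      _ ≤ _ := by gcongr
  have hkd : DifferentiableOn ℂ k (ball y (ρ / 4)) := by
    intro x hx
    have hx' := ball_subset_ball (show ρ / 2 ≤ ρ by linarith) (hsub hx)
    have hfx := hf.differentiableAt (hU.mem_nhds (hball x hx').2)
    refine DifferentiableAt.differentiableWithinAt ?_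
    exact (hfx.sub_const _).sub (J.differentiableAt.comp x (differentiableAt_id.sub_const z))
  have hm : MapsTo k (ball y (ρ / 4)) (closedBall (k y) (ε / 16 * ρ)) := by
    intro x hx
    rw [mem_closedBall, dist_eq_norm]
    have h3 := hkb x (hsub hx)
    have h4 := hkb y (by rw [mem_ball]; linarith)
    linarith [norm_sub_le (k x) (k y)]
  have h5 := Complex.norm_fderiv_le_div_of_mapsTo_ball hkd hm (by positivity)
  rw [hkf] at h5
  rw [dist_eq_norm]
  calc _ ≤ _ := h5
    _ = ε / 4 := by field_simp; norm_num
    _ < ε := by linarith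

/-- The derivative of `‖f‖²` along a great circle through an extremum vanishes. -/
theorem re_inner_map_eq_zero_of_isExtrOn_sphere {f : E → E} {J : E →L[ℂ] E} {z v : E} (hz0 : z ≠ 0)
    (hf : HasFDerivAt f J z) (he : IsExtrOn (fun ξ => ‖f ξ‖) (sphere 0 ‖z‖) z)
    (hv : (inner ℂ z v).re = 0) : (inner ℂ (f z) (J v)).re = 0 := by
  let : InnerProductSpace ℝ E := InnerProductSpace.complexToReal
  rcases eq_or_ne v 0 with rfl | hv0
  · simp
  have hvn := norm_pos_iff.2 hv0
  have hzn := norm_pos_iff.2 hz0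
  obtain ⟨c, hc, hw⟩ : ∃ c : ℝ, c ≠ 0 ∧ ‖c • v‖ = ‖z‖ := by
    refine ⟨‖z‖ / ‖v‖, by positivity, ?_⟩
    rw [norm_smul, Real.norm_of_nonneg (by positivity)]
    field_simp
  have horth : inner ℝ z (c • v) = 0 := by
    rw [inner_smul_right, real_inner_eq_re_inner ℂ]
    simp [hv]
  let γ : ℝ → E := fun t => Real.cos t • z + Real.sin t • (c • v)
  have hγ0 : γ 0 = z := by simp [γ]
  have hγs : ∀ t, γ t ∈ sphere (0 : E) ‖z‖ := by
    intro t
    rw [mem_sphere_zero_iff_norm, ← sq_eq_sq₀ (norm_nonneg _) (norm_nonneg _),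
      norm_add_sq_real, norm_smul, norm_smul, mul_pow, mul_pow, hw, inner_smul_left,
      inner_smul_right, horth]
    simp only [Real.norm_eq_abs, sq_abs]
    linear_combination ‖z‖ ^ 2 * Real.sin_sq_add_cos_sq t
  have hγd : HasDerivAt γ (c • v) 0 := by
    have := ((Real.hasDerivAt_cos 0).smul_const z).add ((Real.hasDerivAt_sin 0).smul_const (c • v))
    simpa [γ, Pi.add_def] using this
  have hd : HasDerivAt (fun t => f (γ t)) (J (c • v)) 0 := by
    have hf' : HasFDerivAt f (J.restrictScalars ℝ) (γ 0) := by
      rw [hγ0]; exact hf.restrictScalars ℝ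
    exact hf'.comp_hasDerivAt 0 hγd
  have hloc : IsLocalExtr (fun t => ‖f (γ t)‖ ^ 2) 0 := by
    rcases he with he | he
    · refine Or.inl (Eventually.of_forall fun t => ?_)
      have := he (hγs t)
      simp only [mem_ofPred_eq, hγ0] at this ⊢
      gcongr
    · refine Or.inr (Eventually.of_forall fun t => ?_)
      have := he (hγs t)
      simp only [mem_ofPred_eq, hγ0] at this ⊢
      gcongr
  have h0 := hloc.hasDerivAt_eq_zero hd.norm_sq
  simp only [hγ0] at h0
  rw [real_inner_eq_re_inner ℂ, ← Complex.coe_smul, map_smul, inner_smul_right] at h0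
  simpa [hc] using h0

theorem inner_map_eq_zero_of_isExtrOn_sphere {f : E → E} {J : E →L[ℂ] E} {z v : E} (hz0 : z ≠ 0)
    (hf : HasFDerivAt f J z) (he : IsExtrOn (fun ξ => ‖f ξ‖) (sphere 0 ‖z‖) z)
    (hv : inner ℂ z v = 0) : inner ℂ (f z) (J v) = 0 := by
  have h1 := re_inner_map_eq_zero_of_isExtrOn_sphere hz0 hf he (v := v) (by simp [hv])
  have h2 := re_inner_map_eq_zero_of_isExtrOn_sphere hz0 hf he (v := Complex.I • v)
    (by simp [hv])
  rw [map_smul, inner_smul_right] at h2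
  apply Complex.ext
  · simpa using h1
  · simpa using h2

theorem inner_map_self_im_eq_zero_of_isExtrOn_sphere {f : E → E} {J : E →L[ℂ] E} {z : E}
    (hz0 : z ≠ 0) (hf : HasFDerivAt f J z)
    (he : IsExtrOn (fun ξ => ‖f ξ‖) (sphere 0 ‖z‖) z) :
    (inner ℂ (f z) (J z)).im = 0 := by
  have h2 := re_inner_map_eq_zero_of_isExtrOn_sphere hz0 hf he (v := Complex.I • z)
    (by rw [inner_smul_right, inner_self_eq_norm_sq_to_K]; simp [← Complex.ofReal_pow])
  rw [map_smul, inner_smul_right] at h2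
  simpa using h2

/-- At an extremum of `‖f‖` on a sphere, where `h = J⁻¹ f(z)`, the quotient `⟨h, z⟩ / ‖z‖²` is real:
only the component of `h` along `z` contributes to `‖f z‖² = ⟨J h, f z⟩`, and `⟨J z, f z⟩` is real. -/
theorem norm_sq_eq_of_isExtrOn_sphere {f : E → E} {J : E →L[ℂ] E} {z h : E} (hz0 : z ≠ 0)
    (hf : HasFDerivAt f J z) (he : IsExtrOn (fun ξ => ‖f ξ‖) (sphere 0 ‖z‖) z)
    (hh : J h = f z) (h0 : f z ≠ 0) :
    ∃ p : ℝ, inner ℂ z h / (‖z‖ : ℂ) ^ 2 = p ∧ ‖f z‖ ^ 2 = p * (inner ℂ (f z) (J z)).re := by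
  have hzn : (‖z‖ : ℂ) ≠ 0 := by simpa using hz0
  set q := inner ℂ z h / (‖z‖ : ℂ) ^ 2 with hq
  have horth : inner ℂ z (h - q • z) = 0 := by
    rw [inner_sub_right, inner_smul_right, inner_self_eq_norm_sq_to_K, hq]
    simp only [Complex.coe_algebraMap]
    field_simp
    simp
  have h1 := inner_map_eq_zero_of_isExtrOn_sphere hz0 hf he horth
  rw [map_sub, map_smul, hh, inner_sub_right, inner_smul_right, inner_self_eq_norm_sq_to_K] at h1
  have him := inner_map_self_im_eq_zero_of_isExtrOn_sphere hz0 hf he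
  set m := inner ℂ (f z) (J z)
  have hm : m = (m.re : ℂ) := by apply Complex.ext <;> simp [him]
  have h2 : ((‖f z‖ ^ 2 : ℝ) : ℂ) = q * m.re := by
    rw [← hm]; push_cast; exact sub_eq_zero.1 h1
  have hmr : m.re ≠ 0 := by
    intro h
    rw [h] at h2
    have : ‖f z‖ ^ 2 = 0 := by exact_mod_cast (by simpa using h2)
    exact h0 (by simpa using this)
  refine ⟨‖f z‖ ^ 2 / m.re, ?_, by field_simp⟩
  rw [Complex.ofReal_div, h2]
  have : (m.re : ℂ) ≠ 0 := by exact_mod_cast hmr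
  field_simp

end FirstOrder

/-! ### The Levi form at an extremum on a sphere -/

section Levi

open Filter Topology Metric Set Asymptotics
variable {E : Type*} [NormedAddCommGroup E] [InnerProductSpace ℂ E]

theorem tendsto_norm_sq_second_difference {F : Type*} [NormedAddCommGroup F]
    [InnerProductSpace ℝ F] {P : ℝ → F} {a b c : F}
    (hP : (fun s : ℝ => P s - (a + s • b + s ^ 2 • c)) =o[𝓝 0] fun s : ℝ => s ^ 2)
    (hab : inner ℝ a b = 0) :
    Tendsto (fun s => (‖P s‖ ^ 2 - ‖a‖ ^ 2) / s ^ 2) (𝓝[≠] 0)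
      (𝓝 (‖b‖ ^ 2 + 2 * inner ℝ a c)) := by
  let Q : ℝ → F := fun s => (s ^ 2)⁻¹ • (P s - (a + s • b + s ^ 2 • c)) + c
  have hQ : Tendsto Q (𝓝[≠] 0) (𝓝 c) := by
    have h1 : Tendsto (fun s : ℝ => (s ^ 2)⁻¹ • (P s - (a + s • b + s ^ 2 • c))) (𝓝[≠] 0)
        (𝓝 0) := by
      exact (hP.mono nhdsWithin_le_nhds).tendsto_inv_smul_nhds_zero
    simpa [Q] using h1.add_const c
  have hs : Tendsto (fun s : ℝ => s) (𝓝[≠] 0) (𝓝 0) := nhdsWithin_le_nhds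
  have hlim : Tendsto (fun s => ‖b + s • Q s‖ ^ 2 + 2 * inner ℝ a (Q s)) (𝓝[≠] 0)
      (𝓝 (‖b + (0 : ℝ) • c‖ ^ 2 + 2 * inner ℝ a c)) :=
    ((tendsto_const_nhds.add (hs.smul hQ)).norm.pow 2).add
      ((tendsto_const_nhds.inner hQ).const_mul 2)
  rw [zero_smul, add_zero] at hlim
  refine hlim.congr' ?_
  filter_upwards [self_mem_nhdsWithin] with s hs0
  have hs0 : s ≠ 0 := hs0
  have hPs : P s = a + s • (b + s • Q s) := by
    simp only [Q, smul_add, smul_smul]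
    rw [show s * (s * (s ^ 2)⁻¹) = 1 by field_simp, ← pow_two]
    module
  rw [hPs, norm_add_sq_real a, inner_smul_right, inner_add_right a b, hab, norm_smul, mul_pow,
    inner_smul_right]
  simp only [Real.norm_eq_abs, sq_abs]
  field_simp
  ring
theorem DifferentiableOn.exists_slice_expansion [CompleteSpace E] {f : E → E} {U : Set E}
    (hf : DifferentiableOn ℂ f U) (hU : IsOpen U) {z : E} (hz : z ∈ U) (v : E) :
    ∃ q : E, (fun w : ℂ => f (z + w • v) - (f z + w • fderiv ℂ f z v + w ^ 2 • q)) =o[𝓝 0]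
      fun w => w ^ 2 := by
  let σ : ℂ → E := fun w => f (z + w • v)
  let L : ℂ → E := fun w => z + w • v
  have hL : Continuous L := by fun_prop
  have hLU : IsOpen (L ⁻¹' U) := hU.preimage hL
  have h0 : (0 : ℂ) ∈ L ⁻¹' U := by simpa [L] using hz
  have hσ : DifferentiableOn ℂ σ (L ⁻¹' U) :=
    hf.comp (by fun_prop) (mapsTo_preimage L U)
  have hσ' : HasDerivAt σ (fderiv ℂ f z v) 0 := by
    have h1 : HasFDerivAt f (fderiv ℂ f z) (L 0) := by
      simpa [L] using (hf.differentiableAt (hU.mem_nhds hz)).hasFDerivAt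
    have h2 : HasDerivAt L v 0 := by
      simpa [L] using ((hasDerivAt_id (0 : ℂ)).smul_const v).const_add z
    exact h1.comp_hasDerivAt 0 h2
  obtain ⟨p, hp⟩ := hσ.analyticAt (hLU.mem_nhds h0)
  refine ⟨p.coeff 2, ?_⟩
  have h3 := hp.isBigO_sub_partialSum_pow 3
  have hc0 : p.coeff 0 = f z := by
    exact (hp.coeff_zero 1).trans (by simp [σ])
  have hc1 : p.coeff 1 = fderiv ℂ f z v := hp.hasDerivAt.unique hσ'
  have h4 : (fun w : ℂ => f (z + w • v) - (f z + w • fderiv ℂ f z v + w ^ 2 • p.coeff 2))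
      =O[𝓝 0] fun w => ‖w‖ ^ 3 := by
    refine h3.congr_left fun w => ?_
    simp [FormalMultilinearSeries.partialSum, Finset.sum_range_succ, hc0, hc1, σ]
  refine h4.trans_isLittleO ?_
  have : (fun w : ℂ => w ^ 3) =o[𝓝 0] fun w => w ^ 2 := isLittleO_pow_pow (by norm_num)
  simpa only [norm_pow] using this.norm_left

theorem sqrt_one_sub_sq_sub_isLittleO :
    (fun s : ℝ => √(1 - s ^ 2) - 1 + s ^ 2 / 2) =o[𝓝 0] fun s => s ^ 2 := by
  have h1 : HasDerivAt (fun x : ℝ => √(1 - x)) (-1 / 2) 0 := by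
    have := ((hasDerivAt_id (0 : ℝ)).const_sub 1).sqrt (by simp)
    simpa using this
  have h2 : Tendsto (fun s : ℝ => s ^ 2) (𝓝 0) (𝓝 0) := by
    have : Continuous fun s : ℝ => s ^ 2 := by fun_prop
    simpa using this.tendsto 0
  have h3 := h1.isLittleO.comp_tendsto h2
  refine (h3.congr_left fun s => ?_).congr_right fun s => ?_
  · simp; ring
  · simp

/-- Second-order expansion of a holomorphic map along the arc `s ↦ √(1 - s²) z + s c v`, where `c`
is a complex constant. The quadratic coefficient depends on `c` only through `c²`. -/
theorem DifferentiableOn.exists_arc_expansion [CompleteSpace E] {f : E → E} {U : Set E}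
    (hf : DifferentiableOn ℂ f U) (hU : IsOpen U) {z : E} (hz : z ∈ U) (v : E) :
    ∃ q : E, ∀ c : ℂ, (fun s : ℝ => f (√(1 - s ^ 2) • z + s • c • v) -
      (f z + s • c • fderiv ℂ f z v + s ^ 2 • (c ^ 2 • q - (1 / 2 : ℝ) • fderiv ℂ f z z)))
        =o[𝓝 0] fun s => s ^ 2 := by
  obtain ⟨q, hq⟩ := hf.exists_slice_expansion hU hz v
  refine ⟨q, fun c => ?_⟩
  set J := fderiv ℂ f z with hJ
  have hcs : Tendsto (fun s : ℝ => (s : ℂ) * c) (𝓝 0) (𝓝 0) := by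
    have : Continuous fun s : ℝ => (s : ℂ) * c := by fun_prop
    simpa using this.tendsto 0
  have e1 : (fun s : ℝ => f (z + s • c • v) - (f z + s • c • J v + s ^ 2 • c ^ 2 • q))
      =o[𝓝 0] fun s => s ^ 2 := by
    refine ((hq.comp_tendsto hcs).trans_isBigO (k := fun s : ℝ => s ^ 2) ?_).congr_left
      fun s => ?_
    · refine IsBigO.of_bound (‖c‖ ^ 2) (Eventually.of_forall fun s => ?_)
      simp [mul_pow, mul_comm]
    · simp only [Function.comp_apply, mul_pow, mul_smul, ← Complex.ofReal_pow, Complex.coe_smul]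
  have hsq := sqrt_one_sub_sq_sub_isLittleO
  have hOs : (fun s : ℝ => √(1 - s ^ 2) - 1) =O[𝓝 0] fun s => s ^ 2 := by
    have h2 : (fun s : ℝ => s ^ 2 / 2) =O[𝓝 0] fun s => s ^ 2 :=
      IsBigO.of_bound (1 / 2) (Eventually.of_forall fun s => by simp; linarith)
    exact (hsq.isBigO.sub h2).congr_left fun s => by ring
  have e2 : (fun s : ℝ => f (√(1 - s ^ 2) • z + s • c • v) - f (z + s • c • v)
      - J ((√(1 - s ^ 2) - 1) • z)) =o[𝓝 0] fun s => s ^ 2 := by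
    have hst := (hf.hasStrictFDerivAt_of_complex hU hz).isLittleO
    have ht : Tendsto (fun s : ℝ => (√(1 - s ^ 2) • z + s • c • v, z + s • c • v)) (𝓝 0)
        (𝓝 (z, z)) := by
      have : Continuous fun s : ℝ => (√(1 - s ^ 2) • z + s • c • v, z + s • c • v) := by fun_prop
      simpa using this.tendsto 0
    have hdiff : ∀ s : ℝ, √(1 - s ^ 2) • z + s • c • v - (z + s • c • v)
        = (√(1 - s ^ 2) - 1) • z := fun s => by module
    refine ((hst.comp_tendsto ht).trans_isBigO ?_).congr_left fun s => ?_
    · have h3 : (fun s : ℝ => (√(1 - s ^ 2) - 1) • z) =O[𝓝 0] fun s => √(1 - s ^ 2) - 1 :=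
        IsBigO.of_bound ‖z‖ (Eventually.of_forall fun s => by rw [norm_smul, mul_comm])
      refine (h3.trans hOs).congr_left fun s => ?_
      simp only [Function.comp_apply, hdiff]
    · simp only [Function.comp_apply, hdiff, hJ]
  have e3 : (fun s : ℝ => (√(1 - s ^ 2) - 1 + s ^ 2 / 2) • J z) =o[𝓝 0] fun s => s ^ 2 := by
    refine IsBigO.trans_isLittleO ?_ hsq
    exact IsBigO.of_bound ‖J z‖ (Eventually.of_forall fun s => by rw [norm_smul, mul_comm])
  refine ((e1.add e2).add e3).congr_left fun s => ?_
  rw [← Complex.coe_smul (√(1 - s ^ 2) - 1) z, map_smul, Complex.coe_smul]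
  module

/-- At a critical point of `‖f‖` on a sphere, the arcs in the directions `v` and `i v` together
see only the Levi form of `‖f‖²`, in which the second derivatives of `f` cancel. -/
theorem tendsto_norm_sq_levi_form [CompleteSpace E] {f : E → E} {U : Set E}
    (hf : DifferentiableOn ℂ f U) (hU : IsOpen U) {z : E} (hz : z ∈ U) (v : E)
    (horth : inner ℂ (f z) (fderiv ℂ f z v) = 0) :
    Tendsto (fun s : ℝ => (‖f (√(1 - s ^ 2) • z + s • (1 : ℂ) • v)‖ ^ 2 - ‖f z‖ ^ 2) / s ^ 2 +
        (‖f (√(1 - s ^ 2) • z + s • Complex.I • v)‖ ^ 2 - ‖f z‖ ^ 2) / s ^ 2)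
      (𝓝[≠] 0) (𝓝 (2 * (‖fderiv ℂ f z v‖ ^ 2 - (inner ℂ (f z) (fderiv ℂ f z z)).re))) := by
  let : InnerProductSpace ℝ E := InnerProductSpace.complexToReal
  obtain ⟨q, hq⟩ := hf.exists_arc_expansion hU hz v
  have h (c : ℂ) : inner ℝ (f z) (c • fderiv ℂ f z v) = 0 := by
    rw [real_inner_eq_re_inner ℂ, inner_smul_right, horth]; simp
  convert (tendsto_norm_sq_second_difference (hq 1) (h 1)).add
    (tendsto_norm_sq_second_difference (hq Complex.I) (h Complex.I)) using 2
  simp only [Complex.I_sq, one_pow, one_smul, neg_smul, inner_sub_right, inner_neg_right,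
    real_inner_eq_re_inner ℂ, norm_smul, Complex.norm_I]
  have hhalf : (inner ℂ (f z) ((1 / 2 : ℝ) • fderiv ℂ f z z)).re
      = 1 / 2 * (inner ℂ (f z) (fderiv ℂ f z z)).re := by
    rw [← Complex.coe_smul, inner_smul_right, Complex.re_ofReal_mul]
  simp only [RCLike.re_eq_complex_re, Complex.sub_re, Complex.neg_re, hhalf]
  ring

theorem arc_mem_sphere {z v : E} (hv : ‖v‖ = ‖z‖) (hzv : inner ℂ z v = 0) {c : ℂ} (hc : ‖c‖ = 1)
    {s : ℝ} (hs : |s| ≤ 1) : √(1 - s ^ 2) • z + s • c • v ∈ sphere (0 : E) ‖z‖ := by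
  let : InnerProductSpace ℝ E := InnerProductSpace.complexToReal
  have hs2 : 0 ≤ 1 - s ^ 2 := by nlinarith [sq_abs s, abs_nonneg s]
  have h0 : inner ℝ z (c • v) = 0 := by
    rw [real_inner_eq_re_inner ℂ, inner_smul_right, hzv]; simp
  rw [mem_sphere_zero_iff_norm, ← sq_eq_sq₀ (norm_nonneg _) (norm_nonneg _),
    norm_add_sq_real, inner_smul_left, inner_smul_right, h0]
  simp only [norm_smul, mul_pow, Real.norm_eq_abs, sq_abs, Real.sq_sqrt hs2, hc, hv]
  ring

theorem eventually_arc_mem_sphere {z v : E} (hv : ‖v‖ = ‖z‖) (hzv : inner ℂ z v = 0) {c : ℂ}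
    (hc : ‖c‖ = 1) :
    ∀ᶠ s : ℝ in 𝓝[≠] 0, √(1 - s ^ 2) • z + s • c • v ∈ sphere (0 : E) ‖z‖ := by
  refine nhdsWithin_le_nhds ?_
  filter_upwards [Metric.closedBall_mem_nhds (0 : ℝ) one_pos] with s hs
  exact arc_mem_sphere hv hzv hc (by simpa using hs)

theorem exists_pos_norm_smul_eq {z v : E} (hz : z ≠ 0) (hv : v ≠ 0) :
    ∃ c : ℝ, 0 < c ∧ ‖(c : ℂ) • v‖ = ‖z‖ ∧ ‖z‖ = c * ‖v‖ := by
  have hzn := norm_pos_iff.2 hz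
  have hvn := norm_pos_iff.2 hv
  refine ⟨‖z‖ / ‖v‖, by positivity, ?_, by field_simp⟩
  rw [norm_smul, Complex.norm_real, Real.norm_of_nonneg (by positivity)]
  field_simp

theorem sq_norm_le_of_normalized {J : E →L[ℂ] E} {z v : E} {μ : ℝ} (hz0 : z ≠ 0)
    (h : ∀ w, ‖w‖ = ‖z‖ → inner ℂ z w = 0 → ‖J w‖ ^ 2 ≤ μ) (hzv : inner ℂ z v = 0) :
    ‖J v‖ ^ 2 ≤ μ / ‖z‖ ^ 2 * ‖v‖ ^ 2 := by
  rcases eq_or_ne v 0 with rfl | hv0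
  · simp
  obtain ⟨c, hc, hw, hzc⟩ := exists_pos_norm_smul_eq hz0 hv0
  have h1 := h _ hw (by rw [inner_smul_right, hzv, mul_zero])
  rw [map_smul, norm_smul, Complex.norm_real, Real.norm_of_nonneg hc.le, mul_pow] at h1
  have hvn := norm_pos_iff.2 hv0
  rw [hzc, mul_pow, div_mul_eq_mul_div, mul_div_mul_right _ _ (by positivity),
    le_div_iff₀ (by positivity)]
  linarith

theorem le_sq_norm_of_normalized {J : E →L[ℂ] E} {z v : E} {μ : ℝ} (hz0 : z ≠ 0)
    (h : ∀ w, ‖w‖ = ‖z‖ → inner ℂ z w = 0 → μ ≤ ‖J w‖ ^ 2) (hzv : inner ℂ z v = 0) :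
    μ / ‖z‖ ^ 2 * ‖v‖ ^ 2 ≤ ‖J v‖ ^ 2 := by
  rcases eq_or_ne v 0 with rfl | hv0
  · simp
  obtain ⟨c, hc, hw, hzc⟩ := exists_pos_norm_smul_eq hz0 hv0
  have h1 := h _ hw (by rw [inner_smul_right, hzv, mul_zero])
  rw [map_smul, norm_smul, Complex.norm_real, Real.norm_of_nonneg hc.le, mul_pow] at h1
  have hvn := norm_pos_iff.2 hv0
  rw [hzc, mul_pow, div_mul_eq_mul_div, mul_div_mul_right _ _ (by positivity),
    div_le_iff₀ (by positivity)]
  linarith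

theorem norm_fderiv_sq_le_of_isMaxOn_sphere [CompleteSpace E] {f : E → E} {U : Set E}
    (hf : DifferentiableOn ℂ f U) (hU : IsOpen U) {z : E} (hz : z ∈ U) (hz0 : z ≠ 0)
    (hm : IsMaxOn (fun ξ => ‖f ξ‖) (sphere 0 ‖z‖) z) {v : E} (hzv : inner ℂ z v = 0) :
    ‖fderiv ℂ f z v‖ ^ 2 ≤ (inner ℂ (f z) (fderiv ℂ f z z)).re / ‖z‖ ^ 2 * ‖v‖ ^ 2 := by
  refine sq_norm_le_of_normalized hz0 (fun w hw hzw => ?_) hzv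
  have horth := inner_map_eq_zero_of_isExtrOn_sphere hz0
    (hf.differentiableAt (hU.mem_nhds hz)).hasFDerivAt (Or.inr hm) hzw
  have hle := le_of_tendsto (tendsto_norm_sq_levi_form hf hU hz w horth) (b := 0) ?_
  · linarith
  filter_upwards [eventually_arc_mem_sphere hw hzw norm_one,
    eventually_arc_mem_sphere hw hzw Complex.norm_I] with s h1 h2
  have h1 := pow_le_pow_left₀ (norm_nonneg _) (hm h1) 2
  have h2 := pow_le_pow_left₀ (norm_nonneg _) (hm h2) 2
  have h3 := div_nonpos_of_nonpos_of_nonneg (sub_nonpos.2 h1) (sq_nonneg s)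
  have h4 := div_nonpos_of_nonpos_of_nonneg (sub_nonpos.2 h2) (sq_nonneg s)
  exact add_nonpos h3 h4

theorem le_norm_fderiv_sq_of_isMinOn_sphere [CompleteSpace E] {f : E → E} {U : Set E}
    (hf : DifferentiableOn ℂ f U) (hU : IsOpen U) {z : E} (hz : z ∈ U) (hz0 : z ≠ 0)
    (hm : IsMinOn (fun ξ => ‖f ξ‖) (sphere 0 ‖z‖) z) {v : E} (hzv : inner ℂ z v = 0) :
    (inner ℂ (f z) (fderiv ℂ f z z)).re / ‖z‖ ^ 2 * ‖v‖ ^ 2 ≤ ‖fderiv ℂ f z v‖ ^ 2 := by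
  refine le_sq_norm_of_normalized hz0 (fun w hw hzw => ?_) hzv
  have horth := inner_map_eq_zero_of_isExtrOn_sphere hz0
    (hf.differentiableAt (hU.mem_nhds hz)).hasFDerivAt (Or.inl hm) hzw
  have hle := ge_of_tendsto (tendsto_norm_sq_levi_form hf hU hz w horth) (b := 0) ?_
  · linarith
  filter_upwards [eventually_arc_mem_sphere hw hzw norm_one,
    eventually_arc_mem_sphere hw hzw Complex.norm_I] with s h1 h2
  have h1 := pow_le_pow_left₀ (norm_nonneg _) (hm h1) 2
  have h2 := pow_le_pow_left₀ (norm_nonneg _) (hm h2) 2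
  exact add_nonneg (div_nonneg (sub_nonneg.2 h1) (sq_nonneg s))
    (div_nonneg (sub_nonneg.2 h2) (sq_nonneg s))
end Levi

/-! ### Subordination and bounds for real values -/

section Subordination

open Filter Topology Metric Set Asymptotics

theorem one_add_ofReal_mul_ne_zero {B : ℝ} (hB : |B| ≤ 1) {ω : ℂ} (hω : ‖ω‖ < 1) :
    1 + (B : ℂ) * ω ≠ 0 := by
  intro h
  have h1 : (B : ℂ) * ω = -1 := by linear_combination h
  have h2 := congrArg norm h1
  rw [norm_mul, Complex.norm_real, norm_neg, norm_one, Real.norm_eq_abs] at h2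
  nlinarith [abs_nonneg B, norm_nonneg ω]

/-- The Schwarz lemma for `ω = (1 - φ) / (B φ - A)`, which is the composition of `φ` with the inverse
of `ζ ↦ (1 + A ζ) / (1 + B ζ)`. -/
theorem norm_one_sub_le_of_mem_gAB_image {A B : ℝ} (hA : -1 ≤ A) (hAB : A < B) (hB : B ≤ 1)
    {φ : ℂ → ℂ} (hφ : DifferentiableOn ℂ φ (ball 0 1)) (h0 : φ 0 = 1)
    (hm : ∀ ζ ∈ ball (0 : ℂ) 1, φ ζ ∈ gAB A B '' ball 0 1) {ζ : ℂ} (hζ : ‖ζ‖ < 1) :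
    ‖1 - φ ζ‖ ≤ ‖ζ‖ * ‖(B : ℂ) * φ ζ - A‖ := by
  have hB' : |B| ≤ 1 := abs_le.2 ⟨by linarith, hB⟩
  have hD : (B : ℂ) - A ≠ 0 := by
    rw [← Complex.ofReal_sub]; exact_mod_cast (sub_pos.2 hAB).ne'
  have key : ∀ ξ ∈ ball (0 : ℂ) 1, (B : ℂ) * φ ξ - A ≠ 0 ∧
      (1 - φ ξ) / (B * φ ξ - A) ∈ ball (0 : ℂ) 1 := by
    intro ξ hξ
    obtain ⟨ω, hω, hωφ⟩ := hm ξ hξ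
    have hne := one_add_ofReal_mul_ne_zero hB' (mem_ball_zero_iff.1 hω)
    have e1 : (B : ℂ) * φ ξ - A = (B - A) / (1 + B * ω) := by
      rw [← hωφ, gAB]; field_simp; ring
    have e2 : 1 - φ ξ = (B - A) * ω / (1 + B * ω) := by
      rw [← hωφ, gAB, eq_div_iff hne, sub_mul, div_mul_cancel₀ _ hne]; ring
    refine ⟨e1 ▸ div_ne_zero hD hne, ?_⟩
    rw [e1, e2]
    convert hω using 1
    field_simp
  have hd : DifferentiableOn ℂ (fun ξ => (1 - φ ξ) / (B * φ ξ - A)) (ball 0 1) :=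
    ((differentiableOn_const _).sub hφ).div ((hφ.const_mul _).sub_const _) fun ξ hξ => (key ξ hξ).1
  have h1 := Complex.norm_le_norm_of_mapsTo_ball hd
    (fun ξ hξ => ball_subset_closedBall (key ξ hξ).2) (by simp [h0]) hζ
  rwa [norm_div, div_le_iff₀ (norm_pos_iff.2 (key ζ (mem_ball_zero_iff.2 hζ)).1)] at h1

/-- The value required to lie in `g(𝔻)` in the definition of `M̃_g^{α,β}`, as a function of
`p = ⟨h(z), z⟩ / ‖z‖²`. -/
noncomputable def tiltedValue (α β : ℝ) (p : ℂ) : ℂ :=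
  (-(α : ℂ) + Complex.I * (Real.tan β : ℂ)) / (1 - (α : ℂ))
    + (1 - Complex.I * (Real.tan β : ℂ)) / (1 - (α : ℂ)) * p

/-- Subordination on the slice of the ball through `z`: the function
`ζ ↦ ⟨h(ζ u), ζ u⟩ / ‖ζ u‖²`, with `u = z / ‖z‖`, is `⟨h(ζ u), u⟩ / ζ` and extends holomorphically to
the disc with value `1` at the origin. -/
theorem IsMTilde.norm_one_sub_tiltedValue_le {n : ℕ} {A B α β : ℝ} (hA : -1 ≤ A) (hAB : A < B)
    (hB : B ≤ 1) (hα : α < 1) {h : EuclideanSpace ℂ (Fin n) → EuclideanSpace ℂ (Fin n)}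
    (hh : IsMTilde (gAB A B) α β h) {z : EuclideanSpace ℂ (Fin n)} (hz : z ∈ ball 0 1)
    (hz0 : z ≠ 0) :
    ‖1 - tiltedValue α β (inner ℂ z (h z) / (‖z‖ : ℂ) ^ 2)‖ ≤
      ‖z‖ * ‖(B : ℂ) * tiltedValue α β (inner ℂ z (h z) / (‖z‖ : ℂ) ^ 2) - A‖ := by
  have hzn : (‖z‖ : ℂ) ≠ 0 := by simpa using hz0
  have hα' : (1 : ℂ) - α ≠ 0 := by
    rw [← Complex.ofReal_one, ← Complex.ofReal_sub]; exact_mod_cast (sub_pos.2 hα).ne'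
  set u : EuclideanSpace ℂ (Fin n) := (‖z‖ : ℂ)⁻¹ • z with hu
  have hun : ‖u‖ = 1 := by
    rw [hu, norm_smul, norm_inv, Complex.norm_real, norm_norm, inv_mul_cancel₀ (by simpa using hz0)]
  have huz : (‖z‖ : ℂ) • u = z := by rw [hu, smul_smul, mul_inv_cancel₀ hzn, one_smul]
  let k : ℂ → ℂ := fun ζ => inner ℂ u (h (ζ • u))
  have hkd : DifferentiableOn ℂ k (ball 0 1) := by
    have h1 : DifferentiableOn ℂ (fun ζ : ℂ => h (ζ • u)) (ball 0 1) := by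
      refine hh.holo.comp (g := h) (f := fun ζ : ℂ => ζ • u) (by fun_prop) fun ζ hζ => ?_
      rw [mem_ball_zero_iff] at *
      rwa [norm_smul, hun, mul_one]
    exact (innerSL ℂ u).differentiable.comp_differentiableOn h1
  have hk0 : k 0 = 0 := by simp [k, hh.map_zero]
  have hk1 : deriv k 0 = 1 := by
    have h1 : HasFDerivAt h (fderiv ℂ h 0) ((0 : ℂ) • u) := by
      rw [zero_smul]
      exact (hh.holo.differentiableAt (ball_mem_nhds 0 one_pos)).hasFDerivAt
    have h2 : HasDerivAt (fun ζ : ℂ => ζ • u) u 0 := by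
      simpa using (hasDerivAt_id (0 : ℂ)).smul_const u
    have h3 : HasDerivAt (fun ζ : ℂ => h (ζ • u)) u 0 := by
      have := h1.comp_hasDerivAt 0 h2
      rwa [hh.deriv_zero] at this
    have h4 := (innerSL ℂ u).hasFDerivAt.comp_hasDerivAt (0 : ℂ) h3
    refine h4.deriv.trans ?_
    rw [innerSL_apply_apply, inner_self_eq_norm_sq_to_K, hun]; simp
  let φ : ℂ → ℂ := fun ζ => tiltedValue α β (dslope k 0 ζ)
  have hφ : DifferentiableOn ℂ φ (ball 0 1) := by
    have := (Complex.differentiableOn_dslope (ball_mem_nhds (0 : ℂ) one_pos)).2 hkd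
    exact (this.const_mul _).const_add _
  have hφ0 : φ 0 = 1 := by
    simp only [φ, tiltedValue, dslope_same, hk1]
    field_simp
    ring
  have hslope : ∀ ζ : ℂ, ζ ≠ 0 →
      dslope k 0 ζ = inner ℂ (ζ • u) (h (ζ • u)) / (‖ζ • u‖ : ℂ) ^ 2 := by
    intro ζ hζ
    rw [dslope_of_ne _ hζ, slope_def_field, hk0, sub_zero, sub_zero, inner_smul_left, norm_smul,
      hun, mul_one, ← Complex.conj_mul', mul_div_mul_left]
    simpa using hζ
  have hφm : ∀ ζ ∈ ball (0 : ℂ) 1, φ ζ ∈ gAB A B '' ball 0 1 := by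
    intro ζ hζ
    rcases eq_or_ne ζ 0 with rfl | hζ0
    · exact ⟨0, by simp, by rw [hφ0]; simp [gAB]⟩
    · simp only [φ, hslope ζ hζ0]
      refine hh.mem_image (ζ • u) ?_ ?_
      · rw [mem_ball_zero_iff] at *
        rwa [norm_smul, hun, mul_one]
      · intro h0
        have := congrArg norm h0
        rw [norm_smul, hun, mul_one, norm_zero] at this
        exact hζ0 (norm_eq_zero.1 this)
  have := norm_one_sub_le_of_mem_gAB_image hA hAB hB hφ hφ0 hφm (ζ := (‖z‖ : ℂ))
    (by simpa using hz)
  simpa only [φ, hslope _ hzn, huz, Complex.norm_real, norm_norm] using this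

/-- An upper bound for the modulus of a point of the image of the disc of radius `r` under
`ζ ↦ (1 + A ζ) / (1 + B ζ)`. -/
theorem norm_le_of_norm_one_sub_le {A B r : ℝ} (hA : -1 ≤ A) (hAB : A < B) (hB : B ≤ 1)
    (hr : 0 ≤ r) (hr1 : r < 1) {G : ℂ} (hG : ‖1 - G‖ ≤ r * ‖(B : ℂ) * G - A‖) :
    ‖G‖ ≤ (1 - A * r) / (1 - B * r) := by
  have hB1 : 0 < 1 - B * r := by nlinarith
  have hB2 : 0 < 1 + B * r := by nlinarith
  have hA2 : 0 ≤ 1 + A * r := by nlinarith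
  have hAB2 : 0 < 1 - r ^ 2 * A * B := by
    have h1 : A * B ≤ 1 := by
      nlinarith [mul_nonneg (show 0 ≤ 1 - A by linarith) (show 0 ≤ 1 + B by linarith),
        mul_nonneg (show 0 ≤ 1 + A by linarith) (show 0 ≤ 1 - B by linarith)]
    nlinarith [mul_le_mul_of_nonneg_left h1 (sq_nonneg r)]
  have h2 := pow_le_pow_left₀ (norm_nonneg _) hG 2
  rw [mul_pow, Complex.sq_norm, Complex.sq_norm, Complex.normSq_apply, Complex.normSq_apply] at h2
  simp only [Complex.sub_re, Complex.one_re, Complex.sub_im, Complex.one_im, Complex.mul_re,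
    Complex.ofReal_re, Complex.ofReal_im, Complex.mul_im] at h2
  have hm : ‖G‖ ^ 2 = G.re ^ 2 + G.im ^ 2 := by
    rw [Complex.sq_norm, Complex.normSq_apply]; ring
  have hX : G.re ≤ ‖G‖ := Complex.re_le_norm G
  set m := ‖G‖
  have h3 : m ^ 2 * (1 - r ^ 2 * B ^ 2) + (1 - r ^ 2 * A ^ 2) ≤ 2 * m * (1 - r ^ 2 * A * B) := by
    have h4 := mul_le_mul_of_nonneg_right hX hAB2.le
    rw [hm]
    linarith
  rw [le_div_iff₀ hB1]
  by_contra! hlt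
  have h4 : (1 + A * r) < m * (1 + B * r) := by
    by_contra! h5
    nlinarith
  nlinarith

/-- A real value `p` satisfying the subordination inequality obeys the bounds for `β = 0`, whatever
`β` is. -/
theorem real_value_bounds {A B α β r p : ℝ} (hA : -1 ≤ A) (hAB : A < B) (hB : B ≤ 1)
    (hα : α < 1) (hr : 0 ≤ r) (hr1 : r < 1)
    (hG : ‖1 - tiltedValue α β p‖ ≤ r * ‖(B : ℂ) * tiltedValue α β p - A‖) :
    (1 + (A - A * α + B * α) * r) / (1 + B * r) ≤ p ∧
      p ≤ (1 - (A - A * α + B * α) * r) / (1 - B * r) := by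
  have hB1 : 0 < 1 - B * r := by nlinarith
  have hB2 : 0 < 1 + B * r := by nlinarith
  have ha : 0 < 1 - α := sub_pos.2 hα
  have hα' : (1 : ℂ) - α ≠ 0 := by
    rw [← Complex.ofReal_one, ← Complex.ofReal_sub]; exact_mod_cast ha.ne'
  set t := Real.tan β with ht
  obtain ⟨u, hu⟩ : ∃ u : ℝ, p = 1 + (1 - α) * u := ⟨(p - 1) / (1 - α), by field_simp; ring⟩
  have hval : tiltedValue α β p = ((1 + u : ℝ) : ℂ) + ((-t * u : ℝ) : ℂ) * Complex.I := by
    rw [tiltedValue, hu, ← ht]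
    push_cast
    field_simp
    ring
  have h2 := pow_le_pow_left₀ (norm_nonneg _) hG 2
  rw [hval, mul_pow, Complex.sq_norm, Complex.sq_norm, Complex.normSq_apply,
    Complex.normSq_apply] at h2
  simp at h2
  -- The left side carries the factor `1 + tan² β ≥ 1`, so this implies its own case `β = 0`.
  have h3 : u ^ 2 * (1 - B ^ 2 * r ^ 2) * (1 + t ^ 2) ≤
      r ^ 2 * ((B - A) ^ 2 + 2 * (B - A) * B * u) := by linarith
  have hBr : 0 < 1 - B ^ 2 * r ^ 2 := by nlinarith
  have h4 : u ^ 2 * (1 - B ^ 2 * r ^ 2) ≤ r ^ 2 * ((B - A) ^ 2 + 2 * (B - A) * B * u) := by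
    have := mul_nonneg (mul_nonneg (sq_nonneg u) hBr.le) (sq_nonneg t)
    linarith
  have h5 : (u * (1 - B * r) - r * (B - A)) * (u * (1 + B * r) + r * (B - A)) ≤ 0 := by
    linarith
  have hD : 0 ≤ r * (B - A) := mul_nonneg hr (sub_pos.2 hAB).le
  have h6 : -(r * (B - A)) ≤ u * (1 + B * r) := by
    by_contra! h
    have : u < 0 := by
      by_contra! h0
      nlinarith
    have h7 : u * (1 - B * r) - r * (B - A) < 0 := by nlinarith
    linarith [mul_pos_of_neg_of_neg h7 (show u * (1 + B * r) + r * (B - A) < 0 by linarith)]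
  have h7 : u * (1 - B * r) ≤ r * (B - A) := by
    by_contra! h
    have : 0 < u := by
      by_contra! h0
      nlinarith
    have h8 : 0 < u * (1 + B * r) + r * (B - A) := by nlinarith
    linarith [mul_pos (show 0 < u * (1 - B * r) - r * (B - A) by linarith) h8]
  rw [div_le_iff₀ hB2, le_div_iff₀ hB1, hu]
  constructor <;> nlinarith

/-- Unlike the upper bound in `real_value_bounds`, the bound `p ≤ F₂` comes from the triangle
inequality for `(1 - i tan β) p = (1 - α) G + (α - i tan β)`. -/
theorem real_value_le_quantF₂ {A B α β r p : ℝ} (hA : -1 ≤ A) (hAB : A < B) (hB : B ≤ 1)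
    (hα : α < 1) (hβ : 0 < Real.cos β) (hr : 0 ≤ r) (hr1 : r < 1)
    (hG : ‖1 - tiltedValue α β p‖ ≤ r * ‖(B : ℂ) * tiltedValue α β p - A‖) :
    p ≤ quantF₂ A B α β r := by
  have ha : 0 < 1 - α := sub_pos.2 hα
  have hα' : (1 : ℂ) - α ≠ 0 := by
    rw [← Complex.ofReal_one, ← Complex.ofReal_sub]; exact_mod_cast ha.ne'
  have h1 := norm_le_of_norm_one_sub_le hA hAB hB hr hr1 hG
  set G := tiltedValue α β p with hGdef
  have hc : (Real.cos β : ℂ) ≠ 0 := by exact_mod_cast hβ.ne'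
  have htan : (Real.tan β : ℂ) = Real.sin β / Real.cos β := by
    rw [Real.tan_eq_sin_div_cos]; push_cast; rfl
  have hcs : (Real.cos β : ℂ) ^ 2 + (Real.sin β : ℂ) ^ 2 = 1 := by
    exact_mod_cast Real.cos_sq_add_sin_sq β
  -- `p` is recovered from `G` through `1 / (1 - i tan β) = cos β e^{iβ}`.
  have hp : (p : ℂ) = Real.cos β * (Real.cos β + Real.sin β * Complex.I) *
      ((1 - α : ℝ) * G + (α + (-Real.tan β : ℝ) * Complex.I)) := by
    have h4 : ((1 - α : ℝ) * G + (α + (-Real.tan β : ℝ) * Complex.I) : ℂ)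
        = (1 - Complex.I * Real.tan β) * p := by
      rw [hGdef, tiltedValue]
      push_cast
      field_simp
      ring
    rw [h4, htan]
    field_simp
    linear_combination -(p : ℂ) * hcs + p * (Real.sin β : ℂ) ^ 2 * Complex.I_sq
  have h2 : ‖(Real.cos β + Real.sin β * Complex.I : ℂ)‖ = 1 := by
    have := Complex.norm_exp_ofReal_mul_I β
    rwa [Complex.exp_mul_I, ← Complex.ofReal_cos, ← Complex.ofReal_sin] at this
  have h3 : ‖(α + (-Real.tan β : ℝ) * Complex.I : ℂ)‖ = √(α ^ 2 + Real.tan β ^ 2) := by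
    rw [Complex.norm_add_mul_I, neg_sq]
  calc p ≤ ‖(p : ℂ)‖ := by rw [Complex.norm_real]; exact le_abs_self p
    _ = Real.cos β * ‖((1 - α : ℝ) * G + (α + (-Real.tan β : ℝ) * Complex.I) : ℂ)‖ := by
      rw [hp, norm_mul, norm_mul, h2, Complex.norm_real, Real.norm_of_nonneg hβ.le, mul_one]
    _ ≤ Real.cos β * ((1 - α) * ‖G‖ + √(α ^ 2 + Real.tan β ^ 2)) := by
      refine mul_le_mul_of_nonneg_left ((norm_add_le _ _).trans_eq ?_) hβ.le
      rw [h3, norm_mul, Complex.norm_real, Real.norm_of_nonneg ha.le]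
    _ ≤ Real.cos β * ((1 - α) * ((1 - A * r) / (1 - B * r)) + √(α ^ 2 + Real.tan β ^ 2)) := by
      gcongr
    _ = quantF₂ A B α β r := by
      rw [quantF₂]; field_simp

theorem quantF₁_le {A B α β r : ℝ} (hA : -1 ≤ A) (hAB : A < B)
    (hα0 : 0 ≤ α) (hα : α < 1) (hβ : 0 < Real.cos β) (hr : 0 ≤ r) (hr1 : r < 1) :
    quantF₁ A B α β r ≤ (1 + (A - A * α + B * α) * r) / (1 + B * r) := by
  have hB2 : 0 < 1 + B * r := by nlinarith
  have ha : 0 < 1 - α := sub_pos.2 hα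
  have hg : 0 ≤ (1 + A * r) / (1 + B * r) := div_nonneg (by nlinarith) hB2.le
  have h1 : (1 + (A - A * α + B * α) * r) / (1 + B * r)
      = α + (1 - α) * ((1 + A * r) / (1 + B * r)) := by
    field_simp; ring
  have h2 : quantF₁ A B α β r = (1 - α) * ((1 + A * r) / (1 + B * r)) * Real.cos β -
      √(α ^ 2 + Real.tan β ^ 2) * Real.cos β := by
    rw [quantF₁]; field_simp
  have h3 := mul_le_of_le_one_right (mul_nonneg ha.le hg) (Real.cos_le_one β)
  have h4 : 0 ≤ √(α ^ 2 + Real.tan β ^ 2) * Real.cos β := by positivity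
  rw [h1, h2]
  linarith
end Subordination

/-! ### Comparison of growth along rays -/

section Growth

open Filter Topology Metric Set Asymptotics

theorem HasDerivAt.nonneg_of_le_left {φ : ℝ → ℝ} {d : ℝ} (hφ : HasDerivAt φ d 1)
    (hle : ∀ t ∈ Ioo (0 : ℝ) 1, φ t ≤ φ 1) : 0 ≤ d := by
  have h1 : Tendsto (slope φ 1) (𝓝[<] 1) (𝓝 d) :=
    (hasDerivAt_iff_tendsto_slope.1 hφ).mono_left (nhdsLT_le_nhdsNE 1)
  refine ge_of_tendsto h1 ?_
  filter_upwards [Ioo_mem_nhdsLT (zero_lt_one (α := ℝ))] with t ht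
  rw [slope_def_field]
  exact div_nonneg_of_nonpos (sub_nonpos.2 (hle t ht)) (sub_nonpos.2 ht.2.le)

variable {E : Type*} [NormedAddCommGroup E] [InnerProductSpace ℂ E]

/-- A function on the unit ball that vanishes at the origin and is radially nonincreasing at the
points where it is maximal on their sphere is nonpositive. -/
theorem nonpos_of_radial_deriv_nonpos [ProperSpace E] {N : E → ℝ}
    (hc : ContinuousOn N (ball 0 1)) (h0 : N 0 = 0)
    (hN : ∀ z ∈ ball (0 : E) 1, z ≠ 0 → IsMaxOn N (sphere 0 ‖z‖) z →
      ∃ d ≤ 0, HasDerivAt (fun t : ℝ => N (t • z)) d 1)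
    {z : E} (hz : z ∈ ball 0 1) : N z ≤ 0 := by
  by_contra! hpos
  have hz1 : ‖z‖ < 1 := mem_ball_zero_iff.1 hz
  have hsub : closedBall (0 : E) ‖z‖ ⊆ ball 0 1 := closedBall_subset_ball hz1
  -- The penalty `ε ‖x‖` makes the radial derivative at the maximum strictly negative.
  set ε := N z / 2 with hε
  obtain ⟨x, hx, hmax⟩ := (isCompact_closedBall (0 : E) ‖z‖).exists_isMaxOn
    (f := fun x => N x - ε * ‖x‖) ⟨0, by simp⟩
    ((hc.mono hsub).sub (by fun_prop))
  have hxz : 0 < N x - ε * ‖x‖ := by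
    have := hmax (show z ∈ closedBall 0 ‖z‖ by simp)
    simp only [mem_ofPred_eq] at this
    nlinarith
  have hx0 : x ≠ 0 := by
    rintro rfl
    simp [h0] at hxz
  have hxn := norm_pos_iff.2 hx0
  rw [mem_closedBall_zero_iff] at hx
  obtain ⟨d, hd, hder⟩ := hN x (hsub (by simpa using hx)) hx0 (by
    intro y hy
    rw [mem_sphere_zero_iff_norm] at hy
    have := hmax (show y ∈ closedBall 0 ‖z‖ by simpa [hy] using hx)
    simp only [mem_ofPred_eq, hy] at this ⊢
    linarith)
  have h1 : HasDerivAt (fun t : ℝ => N (t • x) - ε * (t * ‖x‖)) (d - ε * (1 * ‖x‖)) 1 :=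
    hder.sub (((hasDerivAt_id (1 : ℝ)).mul_const _).const_mul _)
  have h2 := h1.nonneg_of_le_left (by
    intro t ht
    have hn : ‖t • x‖ = t * ‖x‖ := by rw [norm_smul, Real.norm_of_nonneg ht.1.le]
    have := hmax (show t • x ∈ closedBall 0 ‖z‖ by
      rw [mem_closedBall_zero_iff, hn]
      nlinarith [ht.2])
    simp only [mem_ofPred_eq, hn] at this
    simpa using this)
  nlinarith

/-- The primitive `∫₀ʳ κ / (1 + T s) ds`. -/
noncomputable def logGrowth (κ T r : ℝ) : ℝ :=
  if T ≠ 0 then κ / T * Real.log (1 + T * r) else κ * r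

theorem logGrowth_zero (κ T : ℝ) : logGrowth κ T 0 = 0 := by
  simp [logGrowth]

theorem hasDerivAt_logGrowth {κ T r : ℝ} (h : 0 < 1 + T * r) :
    HasDerivAt (logGrowth κ T) (κ / (1 + T * r)) r := by
  by_cases hT : T = 0
  · have h1 : logGrowth κ T = fun r => κ * r := by funext r; simp [logGrowth, hT]
    rw [h1]
    simpa [hT] using (hasDerivAt_id r).const_mul κ
  · have h1 : logGrowth κ T = fun r => κ / T * Real.log (1 + T * r) := by
      funext r; simp [logGrowth, hT]
    rw [h1]
    have h2 : HasDerivAt (fun r : ℝ => 1 + T * r) T r := by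
      simpa using ((hasDerivAt_id r).const_mul T).const_add 1
    refine ((h2.log h.ne').const_mul (κ / T)).congr_deriv ?_
    rw [div_mul_div_comm, mul_comm κ T, mul_div_mul_left _ _ hT]

theorem exp_logGrowth {κ T r : ℝ} (h : 0 < 1 + T * r) :
    Real.exp (logGrowth κ T r) = if T ≠ 0 then (1 + T * r) ^ (κ / T) else Real.exp (κ * r) := by
  unfold logGrowth
  split_ifs with hT
  · rw [Real.rpow_def_of_pos h, mul_comm]
  · rfl

/-- Logarithm of `‖f(z)‖ / ‖z‖` relative to a comparison function of `‖z‖`; at the origin the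
quotient is `0 / 0 = 0`, with logarithm `0`. -/
noncomputable def logDefect (f : E → E) (κ T : ℝ) (z : E) : ℝ :=
  Real.log (‖f z‖ / ‖z‖) - logGrowth κ T ‖z‖

/-- Continuity at the origin uses `f(z) = z + o(z)`. -/
theorem continuousOn_logDefect {f : E → E} {κ T : ℝ} (hT : |T| ≤ 1)
    (hf : DifferentiableOn ℂ f (ball 0 1)) (hf0 : f 0 = 0)
    (hf1 : fderiv ℂ f 0 = ContinuousLinearMap.id ℂ E)
    (hne : ∀ z ∈ ball (0 : E) 1, z ≠ 0 → f z ≠ 0) :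
    ContinuousOn (logDefect f κ T) (ball 0 1) := by
  intro z hz
  refine ContinuousAt.continuousWithinAt ?_
  have hTz : 0 < 1 + T * ‖z‖ := by
    have := abs_le.1 hT
    nlinarith [mem_ball_zero_iff.1 hz, norm_nonneg z]
  have hg : ContinuousAt (fun z : E => logGrowth κ T ‖z‖) z :=
    ContinuousAt.comp (f := fun z : E => ‖z‖) (hasDerivAt_logGrowth hTz).continuousAt
      continuous_norm.continuousAt
  refine ContinuousAt.sub ?_ hg
  rcases eq_or_ne z 0 with rfl | hz0
  · rw [continuousAt_iff_punctured_nhds]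
    have hder : HasFDerivAt f (ContinuousLinearMap.id ℂ E) 0 := by
      rw [← hf1]
      exact (hf.differentiableAt (ball_mem_nhds 0 one_pos)).hasFDerivAt
    have h1 : (fun z => f z - z) =o[𝓝 0] fun z => z := by
      simpa [hf0] using hder.isLittleO
    have h2 : Tendsto (fun z => ‖f z‖ / ‖z‖) (𝓝[≠] 0) (𝓝 1) := by
      rw [tendsto_iff_norm_sub_tendsto_zero]
      have h3 : Tendsto (fun z => ‖f z - z‖ / ‖z‖) (𝓝[≠] 0) (𝓝 0) :=
        (h1.norm_norm.tendsto_div_nhds_zero).mono_left nhdsWithin_le_nhds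
      refine squeeze_zero' (.of_forall fun z => norm_nonneg _) ?_ h3
      filter_upwards [self_mem_nhdsWithin] with z hz0
      have hzn : 0 < ‖z‖ := norm_pos_iff.2 hz0
      rw [Real.norm_eq_abs, div_sub_one hzn.ne', abs_div, abs_of_pos hzn]
      gcongr
      exact abs_norm_sub_norm_le _ _
    have h4 := (Real.continuousAt_log one_ne_zero).tendsto.comp h2
    simpa [hf0, Function.comp_def] using h4
  · have hfz := (hf.differentiableAt (isOpen_ball.mem_nhds hz)).continuousAt
    exact (hfz.norm.div continuous_norm.continuousAt (norm_ne_zero_iff.2 hz0)).log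
      (div_ne_zero (norm_ne_zero_iff.2 (hne z hz hz0)) (norm_ne_zero_iff.2 hz0))

theorem hasDerivAt_logDefect_radial {f : E → E} {J : E →L[ℂ] E} {κ T : ℝ} {z : E} (hz0 : z ≠ 0)
    (hT : 0 < 1 + T * ‖z‖) (hf : HasFDerivAt f J z) (hfz : f z ≠ 0) :
    HasDerivAt (fun t : ℝ => logDefect f κ T (t • z))
      ((inner ℂ (f z) (J z)).re / ‖f z‖ ^ 2 - 1 - κ * ‖z‖ / (1 + T * ‖z‖)) 1 := by
  let : InnerProductSpace ℝ E := InnerProductSpace.complexToReal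
  have hzn := norm_pos_iff.2 hz0
  have hd : HasDerivAt (fun t : ℝ => f (t • z)) (J z) 1 := by
    have hf' : HasFDerivAt f (J.restrictScalars ℝ) ((1 : ℝ) • z) := by
      rw [one_smul]; exact hf.restrictScalars ℝ
    have h1 : HasDerivAt (fun t : ℝ => t • z) z 1 := by
      simpa using (hasDerivAt_id (1 : ℝ)).smul_const z
    exact hf'.comp_hasDerivAt 1 h1
  have h2 : HasDerivAt (fun t : ℝ => Real.log (‖f (t • z)‖ ^ 2) / 2)
      (2 * (inner ℂ (f z) (J z)).re / ‖f z‖ ^ 2 / 2) 1 := by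
    have := (hd.norm_sq.log (by simpa using hfz)).div_const 2
    simp only [one_smul, real_inner_eq_re_inner ℂ] at this
    exact this
  have h3 : HasDerivAt (fun t : ℝ => Real.log (t * ‖z‖)) 1 1 := by
    have := ((hasDerivAt_id (1 : ℝ)).mul_const ‖z‖).log (by simpa using hz0)
    simpa [hzn.ne'] using this
  have h4 : HasDerivAt (fun t : ℝ => logGrowth κ T (t * ‖z‖)) (κ / (1 + T * ‖z‖) * ‖z‖) 1 := by
    have h5 : HasDerivAt (logGrowth κ T) (κ / (1 + T * ‖z‖)) ((1 : ℝ) * ‖z‖) := by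
      rw [one_mul]; exact hasDerivAt_logGrowth hT
    have h6 : HasDerivAt (fun t : ℝ => t * ‖z‖) ‖z‖ 1 := by
      simpa using (hasDerivAt_id (1 : ℝ)).mul_const ‖z‖
    exact h5.comp 1 h6
  have h7 := (h2.sub h3).sub h4
  have heq : (fun t : ℝ => logDefect f κ T (t • z)) =ᶠ[𝓝 1]
      fun t => Real.log (‖f (t • z)‖ ^ 2) / 2 - Real.log (t * ‖z‖) - logGrowth κ T (t * ‖z‖) := by
    have hne : ∀ᶠ t : ℝ in 𝓝 1, f (t • z) ≠ 0 :=
      hd.continuousAt.eventually_ne (by simpa using hfz)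
    filter_upwards [hne, Ioi_mem_nhds (zero_lt_one (α := ℝ))] with t ht ht0
    have hn : ‖t • z‖ = t * ‖z‖ := by rw [norm_smul, Real.norm_of_nonneg (le_of_lt ht0)]
    have ht0 : 0 < t := ht0
    rw [logDefect, hn, Real.log_div (norm_ne_zero_iff.2 ht) (by positivity), Real.log_pow]
    push_cast
    ring
  refine (h7.congr_of_eventuallyEq heq).congr_deriv ?_
  ring

end Growth

/-! ### Determinants of maps that respect an orthogonal splitting -/

section Determinant

open Filter Topology Metric Set Asymptotics

theorem Multiset.norm_prod_le_pow_card {s : Multiset ℂ} {c : ℝ} (hc : 0 ≤ c)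
    (h : ∀ x ∈ s, ‖x‖ ≤ c) : ‖s.prod‖ ≤ c ^ s.card := by
  induction s using Multiset.induction_on with
  | empty => simp
  | cons a s ih =>
    rw [Multiset.prod_cons, norm_mul, Multiset.card_cons, pow_succ']
    exact mul_le_mul (h a (by simp)) (ih fun x hx => h x (by simp [hx])) (norm_nonneg _) hc

theorem Multiset.pow_card_le_norm_prod {s : Multiset ℂ} {c : ℝ} (hc : 0 ≤ c)
    (h : ∀ x ∈ s, c ≤ ‖x‖) : c ^ s.card ≤ ‖s.prod‖ := by
  induction s using Multiset.induction_on with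
  | empty => simp
  | cons a s ih =>
    rw [Multiset.prod_cons, norm_mul, Multiset.card_cons, pow_succ']
    exact mul_le_mul (h a (by simp)) (ih fun x hx => h x (by simp [hx])) (by positivity)
      (norm_nonneg _)

variable {E : Type*} [NormedAddCommGroup E] [InnerProductSpace ℂ E] [FiniteDimensional ℂ E]

theorem card_roots_charpoly (L : E →L[ℂ] E) :
    (L : E →ₗ[ℂ] E).charpoly.roots.card = Module.finrank ℂ E := by
  rw [← LinearMap.charpoly_natDegree (L : E →ₗ[ℂ] E)]
  exact ((IsAlgClosed.splits _).natDegree_eq_card_roots).symm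

theorem det_eq_prod_roots_charpoly (L : E →L[ℂ] E) :
    L.det = (L : E →ₗ[ℂ] E).charpoly.roots.prod :=
  Module.End.det_eq_prod_roots_charpoly_of_splits (IsAlgClosed.splits _)

theorem exists_eigenvector_of_mem_roots {L : E →L[ℂ] E} {μ : ℂ}
    (hμ : μ ∈ (L : E →ₗ[ℂ] E).charpoly.roots) : ∃ v, 0 < ‖v‖ ∧ ‖L v‖ = ‖μ‖ * ‖v‖ := by
  have h1 := (Module.End.hasEigenvalue_iff_isRoot_charpoly (L : E →ₗ[ℂ] E) μ).2
    (Polynomial.isRoot_of_mem_roots hμ)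
  obtain ⟨v, hv⟩ := h1.exists_hasEigenvector
  refine ⟨v, norm_pos_iff.2 hv.2, ?_⟩
  rw [← norm_smul, ← hv.apply_eq_smul]
  rfl

theorem norm_det_le_pow {L : E →L[ℂ] E} {c : ℝ} (hc : 0 ≤ c) (h : ∀ v, ‖L v‖ ≤ c * ‖v‖) :
    ‖L.det‖ ≤ c ^ Module.finrank ℂ E := by
  rw [det_eq_prod_roots_charpoly, ← card_roots_charpoly L]
  refine Multiset.norm_prod_le_pow_card hc fun μ hμ => ?_
  obtain ⟨v, hv, hLv⟩ := exists_eigenvector_of_mem_roots hμ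
  exact le_of_mul_le_mul_right (hLv ▸ h v) hv

theorem pow_le_norm_det {L : E →L[ℂ] E} {c : ℝ} (hc : 0 ≤ c) (h : ∀ v, c * ‖v‖ ≤ ‖L v‖) :
    c ^ Module.finrank ℂ E ≤ ‖L.det‖ := by
  rw [det_eq_prod_roots_charpoly, ← card_roots_charpoly L]
  refine Multiset.pow_card_le_norm_prod hc fun μ hμ => ?_
  obtain ⟨v, hv, hLv⟩ := exists_eigenvector_of_mem_roots hμ
  exact le_of_mul_le_mul_right (hLv ▸ h v) hv

/-- Let `J` map the orthogonal complement of `z` into that of `J h`. The map `L` that agrees with `J`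
on the complement of `z` and sends `z` to `(1 / √p) J h` respects these orthogonal splittings and
stretches the line `ℂ z` by `‖J h‖ / (√p ‖z‖)`. As `L` is `J` composed with a transvection of
determinant `√p`, its determinant is known exactly. -/
theorem exists_orthogonal_modification {J : E →L[ℂ] E} {z h : E} {p : ℝ} (hz0 : z ≠ 0)
    (hp : 0 < p) (hzh : inner ℂ z h / (‖z‖ : ℂ) ^ 2 = p)
    (horth : ∀ w, inner ℂ z w = 0 → inner ℂ (J h) (J w) = 0) :
    ∃ L : E →L[ℂ] E, ‖L.det‖ = ‖J.det‖ * √p ∧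
      ∀ v, ∃ a : ℝ, ∃ w, inner ℂ z w = 0 ∧ ‖v‖ ^ 2 = a ^ 2 + ‖w‖ ^ 2 ∧
        ‖L v‖ ^ 2 = (‖J h‖ / (√p * ‖z‖)) ^ 2 * a ^ 2 + ‖J w‖ ^ 2 := by
  have hzn := norm_pos_iff.2 hz0
  have hzn' : (‖z‖ : ℂ) ≠ 0 := by simpa using hz0
  have hsp : 0 < √p := Real.sqrt_pos.2 hp
  have hsp' : (√p : ℂ) ≠ 0 := by exact_mod_cast hsp.ne'
  let φ : E →L[ℂ] ℂ := ((‖z‖ : ℂ) ^ 2)⁻¹ • innerSL ℂ z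
  have hφ : ∀ v, φ v = inner ℂ z v / (‖z‖ : ℂ) ^ 2 := fun v => by
    simp [φ, div_eq_inv_mul]
  have hφz : φ z = 1 := by
    rw [hφ, inner_self_eq_norm_sq_to_K]
    exact div_self (pow_ne_zero 2 hzn')
  have hφh : φ h = p := by rw [hφ, hzh]
  let x : E := (√p : ℂ)⁻¹ • h - z
  let L : E →L[ℂ] E := J.comp (ContinuousLinearMap.id ℂ E + φ.smulRight x)
  refine ⟨L, ?_, fun v => ?_⟩
  · have h1 : L.det = J.det * (1 + φ x) := by
      rw [← ContinuousLinearMap.coe_coe φ, ← LinearMap.transvection.det (φ : E →ₗ[ℂ] ℂ) x]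
      exact LinearMap.det_comp _ _
    have h2 : 1 + φ x = (√p : ℝ) := by
      have : (p : ℂ) = (√p : ℂ) * √p := by exact_mod_cast (Real.mul_self_sqrt hp.le).symm
      simp only [x, map_sub, map_smul, hφz, hφh, smul_eq_mul]
      rw [this]
      field_simp
      ring
    rw [h1, h2, norm_mul, Complex.norm_real, Real.norm_of_nonneg hsp.le]
  · set w := v - φ v • z with hw
    have hzw : inner ℂ z w = 0 := by
      have h1 : φ w = 0 := by rw [hw, map_sub, map_smul, hφz, smul_eq_mul, mul_one, sub_self]
      rw [hφ, div_eq_zero_iff] at h1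
      exact h1.resolve_right (pow_ne_zero 2 hzn')
    refine ⟨‖φ v‖ * ‖z‖, w, hzw, ?_, ?_⟩
    · have hv : v = φ v • z + w := by rw [hw]; abel
      have := norm_add_sq_eq_norm_sq_add_norm_sq_of_inner_eq_zero (φ v • z) w
        (by rw [inner_smul_left, hzw, mul_zero]) (𝕜 := ℂ)
      rw [← hv, norm_smul] at this
      linarith
    · have hL : L v = (φ v * (√p : ℂ)⁻¹) • J h + J w := by
        simp only [L, x, hw, ContinuousLinearMap.comp_apply, add_apply,
          ContinuousLinearMap.id_apply, ContinuousLinearMap.smulRight_apply, map_add, map_sub,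
          map_smul]
        module
      have := norm_add_sq_eq_norm_sq_add_norm_sq_of_inner_eq_zero ((φ v * (√p : ℂ)⁻¹) • J h) (J w)
        (by rw [inner_smul_left, horth w hzw, mul_zero]) (𝕜 := ℂ)
      rw [← hL, norm_smul, norm_mul, norm_inv, Complex.norm_real, Real.norm_of_nonneg hsp.le]
        at this
      rw [pow_two ‖L v‖, this]
      field_simp

theorem norm_det_mul_sqrt_le {J : E →L[ℂ] E} {z h : E} {p : ℝ} (hz0 : z ≠ 0)
    (hp : 0 < p) (hzh : inner ℂ z h / (‖z‖ : ℂ) ^ 2 = p)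
    (horth : ∀ w, inner ℂ z w = 0 → inner ℂ (J h) (J w) = 0)
    (hle : ∀ w, inner ℂ z w = 0 → ‖J w‖ ≤ ‖J h‖ / (√p * ‖z‖) * ‖w‖) :
    ‖J.det‖ * √p ≤ (‖J h‖ / (√p * ‖z‖)) ^ Module.finrank ℂ E := by
  obtain ⟨L, hL, hv⟩ := exists_orthogonal_modification hz0 hp hzh horth
  rw [← hL]
  refine norm_det_le_pow (by positivity) fun v => ?_
  obtain ⟨a, w, hw, h1, h2⟩ := hv v
  have h3 := pow_le_pow_left₀ (norm_nonneg _) (hle w hw) 2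
  refine le_of_sq_le_sq ?_ (by positivity)
  rw [h2, mul_pow, h1]
  linarith [mul_pow (‖J h‖ / (√p * ‖z‖)) ‖w‖ 2]

theorem le_norm_det_mul_sqrt {J : E →L[ℂ] E} {z h : E} {p : ℝ} (hz0 : z ≠ 0)
    (hp : 0 < p) (hzh : inner ℂ z h / (‖z‖ : ℂ) ^ 2 = p)
    (horth : ∀ w, inner ℂ z w = 0 → inner ℂ (J h) (J w) = 0)
    (hle : ∀ w, inner ℂ z w = 0 → ‖J h‖ / (√p * ‖z‖) * ‖w‖ ≤ ‖J w‖) :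
    (‖J h‖ / (√p * ‖z‖)) ^ Module.finrank ℂ E ≤ ‖J.det‖ * √p := by
  obtain ⟨L, hL, hv⟩ := exists_orthogonal_modification hz0 hp hzh horth
  rw [← hL]
  refine pow_le_norm_det (by positivity) fun v => ?_
  obtain ⟨a, w, hw, h1, h2⟩ := hv v
  have h3 := pow_le_pow_left₀ (by positivity) (hle w hw) 2
  refine le_of_sq_le_sq ?_ (norm_nonneg _)
  rw [h2, mul_pow, h1]
  linarith [mul_pow (‖J h‖ / (√p * ‖z‖)) ‖w‖ 2]

end Determinant

/-! ### Growth and distortion in the class `Ŝ_g^{α,β}` -/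

section Spirallike

open Filter Topology Metric Set Asymptotics

theorem abs_paramT_le_one {A B α : ℝ} (hA : -1 ≤ A) (hAB : A < B) (hB : B ≤ 1) (hα0 : 0 ≤ α)
    (hα : α < 1) : |paramT A B α| ≤ 1 := by
  rw [paramT, abs_le]
  constructor <;> nlinarith

theorem IsNormalizedLocBihol.apply_inverse {n : ℕ}
    {f : EuclideanSpace ℂ (Fin n) → EuclideanSpace ℂ (Fin n)} (hf : IsNormalizedLocBihol f)
    {z : EuclideanSpace ℂ (Fin n)} (hz : z ∈ ball 0 1) :
    fderiv ℂ f z ((fderiv ℂ f z).inverse (f z)) = f z := by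
  have h : (fderiv ℂ f z).IsInvertible :=
    ⟨(fderiv ℂ f z).toContinuousLinearEquivOfDetNeZero (hf.det_ne_zero z hz), by simp⟩
  exact h.self_apply_inverse (f z)

variable {n : ℕ} {A B α β : ℝ} {f : EuclideanSpace ℂ (Fin n) → EuclideanSpace ℂ (Fin n)}

/-- A zero of `f` is a zero of `p`, but `0` is not an admissible real value of `p`. -/
theorem SHat.ne_zero (hA : -1 ≤ A) (hAB : A < B) (hB : B ≤ 1) (hα0 : 0 ≤ α) (hα : α < 1)
    (hf : f ∈ SHat n (gAB A B) α β) {z : EuclideanSpace ℂ (Fin n)} (hz : z ∈ ball 0 1)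
    (hz0 : z ≠ 0) : f z ≠ 0 := by
  intro h0
  have h1 := hf.2.norm_one_sub_tiltedValue_le hA hAB hB hα hz hz0
  simp only [h0, map_zero, inner_zero_right, zero_div] at h1
  rw [← Complex.ofReal_zero] at h1
  have hz1 := mem_ball_zero_iff.1 hz
  have h2 := (real_value_bounds hA hAB hB hα (norm_nonneg z) hz1 h1).1
  have hT := abs_le.1 (abs_paramT_le_one hA hAB hB hα0 hα)
  rw [paramT] at hT
  have h3 : 0 < 1 + B * ‖z‖ := by nlinarith [norm_nonneg z]
  have h4 : 0 < 1 + (A - A * α + B * α) * ‖z‖ := by nlinarith [norm_nonneg z]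
  exact absurd h2 (not_le.2 (div_pos h4 h3))

/-- At an extremum of `‖f‖` on a sphere, `p = ⟨J_f(z)⁻¹ f(z), z⟩ / ‖z‖²` is a positive real number,
and it is bounded as if `β` were `0`. -/
theorem SHat.exists_real_value (hA : -1 ≤ A) (hAB : A < B) (hB : B ≤ 1) (hα0 : 0 ≤ α) (hα : α < 1)
    (hβ : 0 < Real.cos β) (hf : f ∈ SHat n (gAB A B) α β) {z : EuclideanSpace ℂ (Fin n)}
    (hz : z ∈ ball 0 1) (hz0 : z ≠ 0) (he : IsExtrOn (fun ξ => ‖f ξ‖) (sphere 0 ‖z‖) z) :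
    ∃ p : ℝ, 0 < p ∧ inner ℂ z ((fderiv ℂ f z).inverse (f z)) / (‖z‖ : ℂ) ^ 2 = p ∧
      ‖f z‖ ^ 2 = p * (inner ℂ (f z) (fderiv ℂ f z z)).re ∧
      (1 + paramT A B α * ‖z‖) / (1 + B * ‖z‖) ≤ p ∧
      p ≤ (1 - paramT A B α * ‖z‖) / (1 - B * ‖z‖) ∧
      quantF₁ A B α β ‖z‖ ≤ p ∧ p ≤ quantF₂ A B α β ‖z‖ := by
  have hz1 := mem_ball_zero_iff.1 hz
  have hfz := SHat.ne_zero hA hAB hB hα0 hα hf hz hz0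
  have hd := (hf.1.holo.differentiableAt (isOpen_ball.mem_nhds hz)).hasFDerivAt
  obtain ⟨p, hp, hfp⟩ := norm_sq_eq_of_isExtrOn_sphere hz0 hd he (hf.1.apply_inverse hz) hfz
  have h1 := hf.2.norm_one_sub_tiltedValue_le hA hAB hB hα hz hz0
  simp only [hp] at h1
  obtain ⟨h2, h3⟩ := real_value_bounds hA hAB hB hα (norm_nonneg z) hz1 h1
  have h4 := real_value_le_quantF₂ hA hAB hB hα hβ (norm_nonneg z) hz1 h1
  have hT := abs_le.1 (abs_paramT_le_one hA hAB hB hα0 hα)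
  have h5 : 0 < 1 + B * ‖z‖ := by nlinarith [norm_nonneg z]
  have h6 : 0 < 1 + paramT A B α * ‖z‖ := by nlinarith [norm_nonneg z]
  exact ⟨p, (div_pos h6 h5).trans_le h2, hp, hfp, h2, h3,
    (quantF₁_le hA hAB hα0 hα hβ (norm_nonneg z) hz1).trans h2, h4⟩

/-- The upper growth bound; the comparison uses that `(1 + B r) / (1 + T r) = 1 + r κ / (1 + T r)`
for `κ = (B - A)(1 - α)`. -/
theorem SHat.norm_div_le (hA : -1 ≤ A) (hAB : A < B) (hB : B ≤ 1) (hα0 : 0 ≤ α) (hα : α < 1)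
    (hβ : 0 < Real.cos β) (hf : f ∈ SHat n (gAB A B) α β) {z : EuclideanSpace ℂ (Fin n)}
    (hz : z ∈ ball 0 1) (hz0 : z ≠ 0) :
    ‖f z‖ / ‖z‖ ≤ Real.exp (logGrowth ((B - A) * (1 - α)) (paramT A B α) ‖z‖) := by
  have hT := abs_paramT_le_one hA hAB hB hα0 hα
  have hne := fun x hx hx0 => SHat.ne_zero hA hAB hB hα0 hα hf (z := x) hx hx0
  have h := nonpos_of_radial_deriv_nonpos (N := logDefect f ((B - A) * (1 - α)) (paramT A B α))
    (continuousOn_logDefect hT hf.1.holo hf.1.map_zero hf.1.deriv_zero hne)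
    (by simp [logDefect, logGrowth_zero]) ?_ hz
  · rw [logDefect, sub_nonpos] at h
    rwa [← Real.log_le_iff_le_exp]
    exact div_pos (norm_pos_iff.2 (hne z hz hz0)) (norm_pos_iff.2 hz0)
  intro x hx hx0 hmax
  have hxn := norm_pos_iff.2 hx0
  have hx1 := mem_ball_zero_iff.1 hx
  have hfx := norm_pos_iff.2 (hne x hx hx0)
  have hm : IsMaxOn (fun ξ => ‖f ξ‖) (sphere 0 ‖x‖) x := by
    intro y hy
    have h1 := hmax hy
    rw [mem_sphere_zero_iff_norm] at hy
    have hy0 : y ≠ 0 := norm_pos_iff.1 (hy ▸ hxn)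
    have hfy := norm_pos_iff.2 (hne y (by rw [mem_ball_zero_iff, hy]; exact hx1) hy0)
    simp only [mem_ofPred_eq, logDefect, hy] at h1 ⊢
    rwa [sub_le_sub_iff_right, Real.log_le_log_iff (by positivity) (by positivity),
      div_le_div_iff_of_pos_right hxn] at h1
  obtain ⟨p, hp, -, hfp, hlow, -⟩ :=
    SHat.exists_real_value hA hAB hB hα0 hα hβ hf hx hx0 (Or.inr hm)
  have hT' := abs_le.1 hT
  have hT1 : 0 < 1 + paramT A B α * ‖x‖ := by nlinarith
  have hB1 : 0 < 1 + B * ‖x‖ := by nlinarith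
  refine ⟨_, ?_, hasDerivAt_logDefect_radial hx0 hT1
    (hf.1.holo.differentiableAt (isOpen_ball.mem_nhds hx)).hasFDerivAt (hne x hx hx0)⟩
  have h1 : (inner ℂ (f x) (fderiv ℂ f x x)).re / ‖f x‖ ^ 2 = 1 / p := by
    rw [div_eq_div_iff (by positivity) hp.ne', hfp]; ring
  have h2 : 1 / p ≤ (1 + B * ‖x‖) / (1 + paramT A B α * ‖x‖) := by
    exact (one_div_le_one_div_of_le (div_pos hT1 hB1) hlow).trans_eq (one_div_div _ _)
  have h3 : (1 + B * ‖x‖) / (1 + paramT A B α * ‖x‖)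
      = 1 + (B - A) * (1 - α) * ‖x‖ / (1 + paramT A B α * ‖x‖) := by
    rw [div_eq_iff hT1.ne', add_mul, div_mul_cancel₀ _ hT1.ne', paramT]
    ring
  rw [h1]
  linarith

/-- The lower growth bound. Its comparison function is the upper one with `κ` and `T` negated. -/
theorem SHat.le_norm_div (hA : -1 ≤ A) (hAB : A < B) (hB : B ≤ 1) (hα0 : 0 ≤ α) (hα : α < 1)
    (hβ : 0 < Real.cos β) (hf : f ∈ SHat n (gAB A B) α β) {z : EuclideanSpace ℂ (Fin n)}
    (hz : z ∈ ball 0 1) (hz0 : z ≠ 0) :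
    Real.exp (logGrowth (-((B - A) * (1 - α))) (-paramT A B α) ‖z‖) ≤ ‖f z‖ / ‖z‖ := by
  have hT := abs_paramT_le_one hA hAB hB hα0 hα
  have hne := fun x hx hx0 => SHat.ne_zero hA hAB hB hα0 hα hf (z := x) hx hx0
  have h := nonpos_of_radial_deriv_nonpos
    (N := fun x => -logDefect f (-((B - A) * (1 - α))) (-paramT A B α) x)
    (continuousOn_logDefect (by rwa [abs_neg]) hf.1.holo hf.1.map_zero hf.1.deriv_zero hne).neg
    (by simp [logDefect, logGrowth_zero]) ?_ hz
  · rw [logDefect, neg_sub, sub_nonpos] at h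
    rwa [← Real.le_log_iff_exp_le]
    exact div_pos (norm_pos_iff.2 (hne z hz hz0)) (norm_pos_iff.2 hz0)
  intro x hx hx0 hmax
  have hxn := norm_pos_iff.2 hx0
  have hx1 := mem_ball_zero_iff.1 hx
  have hfx := norm_pos_iff.2 (hne x hx hx0)
  have hm : IsMinOn (fun ξ => ‖f ξ‖) (sphere 0 ‖x‖) x := by
    intro y hy
    have h1 := hmax hy
    rw [mem_sphere_zero_iff_norm] at hy
    have hy0 : y ≠ 0 := norm_pos_iff.1 (hy ▸ hxn)
    have hfy := norm_pos_iff.2 (hne y (by rw [mem_ball_zero_iff, hy]; exact hx1) hy0)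
    simp only [mem_ofPred_eq, logDefect, hy] at h1 ⊢
    rwa [neg_le_neg_iff, sub_le_sub_iff_right, Real.log_le_log_iff (by positivity) (by positivity),
      div_le_div_iff_of_pos_right hxn] at h1
  obtain ⟨p, hp, -, hfp, -, hup, -⟩ :=
    SHat.exists_real_value hA hAB hB hα0 hα hβ hf hx hx0 (Or.inl hm)
  have hT' := abs_le.1 hT
  have hT1 : 0 < 1 + -paramT A B α * ‖x‖ := by nlinarith
  have hB1 : 0 < 1 - B * ‖x‖ := by nlinarith
  refine ⟨_, ?_, (hasDerivAt_logDefect_radial hx0 hT1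
    (hf.1.holo.differentiableAt (isOpen_ball.mem_nhds hx)).hasFDerivAt (hne x hx hx0)).neg⟩
  have h1 : (inner ℂ (f x) (fderiv ℂ f x x)).re / ‖f x‖ ^ 2 = 1 / p := by
    rw [div_eq_div_iff (by positivity) hp.ne', hfp]; ring
  have h2 : (1 - B * ‖x‖) / (1 + -paramT A B α * ‖x‖) ≤ 1 / p := by
    rw [← one_div_div]
    refine one_div_le_one_div_of_le hp (hup.trans_eq ?_)
    ring
  have h3 : (1 - B * ‖x‖) / (1 + -paramT A B α * ‖x‖)
      = 1 + -((B - A) * (1 - α)) * ‖x‖ / (1 + -paramT A B α * ‖x‖) := by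
    rw [div_eq_iff hT1.ne', add_mul, div_mul_cancel₀ _ hT1.ne', paramT]
    ring
  rw [h1]
  linarith

theorem one_div_rpow_half {F : ℝ} (hF : 0 < F) (n : ℕ) :
    (1 / F) ^ (((n : ℝ) + 1) / 2) = (1 / √F) ^ (n + 1) := by
  rw [Real.sqrt_eq_rpow, one_div, one_div, ← Real.rpow_neg hF.le, ← Real.rpow_natCast,
    ← Real.rpow_mul hF.le, Real.inv_rpow hF.le, ← Real.rpow_neg hF.le]
  congr 1
  push_cast
  ring

theorem rpow_neg_half {F : ℝ} (hF : 0 < F) (n : ℕ) :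
    F ^ (-(((n : ℝ) + 1) / 2)) = (1 / √F) ^ (n + 1) := by
  rw [← one_div_rpow_half hF, one_div, Real.inv_rpow hF.le, Real.rpow_neg hF.le]

theorem exp_logGrowth_pow {κ T r : ℝ} (h : 0 < 1 + T * r) (n : ℕ) :
    Real.exp (logGrowth κ T r) ^ n =
      if T ≠ 0 then (1 + T * r) ^ (n * κ / T) else Real.exp (n * κ * r) := by
  rw [exp_logGrowth h]
  split_ifs with hT
  · rw [← Real.rpow_natCast, ← Real.rpow_mul h.le]
    congr 1
    ring
  · rw [← Real.exp_nat_mul]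
    congr 1
    ring

theorem SHat.norm_det_le_of_isMaxOn (hA : -1 ≤ A) (hAB : A < B) (hB : B ≤ 1) (hα0 : 0 ≤ α)
    (hα : α < 1) (hβ : 0 < Real.cos β) (hf : f ∈ SHat n (gAB A B) α β)
    {z : EuclideanSpace ℂ (Fin n)} (hz : z ∈ ball 0 1) (hz0 : z ≠ 0)
    (hm : IsMaxOn (fun ξ => ‖f ξ‖) (sphere 0 ‖z‖) z) (hF : 0 < quantF₁ A B α β ‖z‖) :
    ‖(fderiv ℂ f z).det‖ ≤
        Real.exp (logGrowth ((B - A) * (1 - α)) (paramT A B α) ‖z‖) ^ n *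
          (1 / √(quantF₁ A B α β ‖z‖)) ^ (n + 1) ∧
      ∀ δ ∈ holoTangent z, ‖fderiv ℂ f z δ‖ ≤
        Real.exp (logGrowth ((B - A) * (1 - α)) (paramT A B α) ‖z‖) *
          (1 / √(quantF₁ A B α β ‖z‖)) * ‖δ‖ := by
  have hzn := norm_pos_iff.2 hz0
  obtain ⟨p, hp, hzp, hfp, -, -, hFp, -⟩ :=
    SHat.exists_real_value hA hAB hB hα0 hα hβ hf hz hz0 (Or.inr hm)
  have hgr := SHat.norm_div_le hA hAB hB hα0 hα hβ hf hz hz0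
  have hJh := hf.1.apply_inverse hz
  have hd := (hf.1.holo.differentiableAt (isOpen_ball.mem_nhds hz)).hasFDerivAt
  have hsF : 0 < √(quantF₁ A B α β ‖z‖) := Real.sqrt_pos.2 hF
  have hsp : 0 < √p := Real.sqrt_pos.2 hp
  have hsle : 1 / √p ≤ 1 / √(quantF₁ A B α β ‖z‖) :=
    one_div_le_one_div_of_le hsF (Real.sqrt_le_sqrt hFp)
  have htan : ∀ w, inner ℂ z w = 0 → ‖fderiv ℂ f z w‖ ≤ ‖f z‖ / (√p * ‖z‖) * ‖w‖ := by
    intro w hw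
    refine le_of_sq_le_sq ((norm_fderiv_sq_le_of_isMaxOn_sphere hf.1.holo isOpen_ball hz hz0 hm
      hw).trans_eq ?_) (by positivity)
    rw [mul_pow, div_pow, mul_pow, Real.sq_sqrt hp.le, hfp]
    field_simp
  have hc : ‖f z‖ / (√p * ‖z‖) = ‖f z‖ / ‖z‖ * (1 / √p) := by field_simp
  constructor
  · have h1 := norm_det_mul_sqrt_le hz0 hp hzp
      (fun w hw => by
        rw [hJh]; exact inner_map_eq_zero_of_isExtrOn_sphere hz0 hd (Or.inr hm) hw)
      (by rw [hJh]; exact htan)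
    rw [hJh, finrank_euclideanSpace_fin, hc, ← le_div_iff₀ hsp] at h1
    calc _ ≤ _ := h1
      _ = (‖f z‖ / ‖z‖) ^ n * (1 / √p) ^ (n + 1) := by rw [mul_pow, pow_succ]; ring
      _ ≤ _ := by gcongr
  · intro δ hδ
    calc _ ≤ _ := htan δ hδ
      _ = ‖f z‖ / ‖z‖ * (1 / √p) * ‖δ‖ := by rw [hc]
      _ ≤ _ := by gcongr

theorem SHat.le_norm_det_of_isMinOn (hA : -1 ≤ A) (hAB : A < B) (hB : B ≤ 1) (hα0 : 0 ≤ α)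
    (hα : α < 1) (hβ : 0 < Real.cos β) (hf : f ∈ SHat n (gAB A B) α β)
    {z : EuclideanSpace ℂ (Fin n)} (hz : z ∈ ball 0 1) (hz0 : z ≠ 0)
    (hm : IsMinOn (fun ξ => ‖f ξ‖) (sphere 0 ‖z‖) z) :
    0 < quantF₂ A B α β ‖z‖ ∧
    Real.exp (logGrowth (-((B - A) * (1 - α))) (-paramT A B α) ‖z‖) ^ n *
          (1 / √(quantF₂ A B α β ‖z‖)) ^ (n + 1) ≤ ‖(fderiv ℂ f z).det‖ ∧
      ∀ δ ∈ holoTangent z,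
        Real.exp (logGrowth (-((B - A) * (1 - α))) (-paramT A B α) ‖z‖) *
          (1 / √(quantF₂ A B α β ‖z‖)) * ‖δ‖ ≤ ‖fderiv ℂ f z δ‖ := by
  have hzn := norm_pos_iff.2 hz0
  obtain ⟨p, hp, hzp, hfp, -, -, -, hFp⟩ :=
    SHat.exists_real_value hA hAB hB hα0 hα hβ hf hz hz0 (Or.inl hm)
  have hgr := SHat.le_norm_div hA hAB hB hα0 hα hβ hf hz hz0
  have hJh := hf.1.apply_inverse hz
  have hd := (hf.1.holo.differentiableAt (isOpen_ball.mem_nhds hz)).hasFDerivAt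
  have hsp : 0 < √p := Real.sqrt_pos.2 hp
  have hsle : 1 / √(quantF₂ A B α β ‖z‖) ≤ 1 / √p :=
    one_div_le_one_div_of_le hsp (Real.sqrt_le_sqrt hFp)
  have htan : ∀ w, inner ℂ z w = 0 → ‖f z‖ / (√p * ‖z‖) * ‖w‖ ≤ ‖fderiv ℂ f z w‖ := by
    intro w hw
    refine le_of_sq_le_sq (le_of_eq_of_le ?_ (le_norm_fderiv_sq_of_isMinOn_sphere hf.1.holo
      isOpen_ball hz hz0 hm hw)) (norm_nonneg _)
    rw [mul_pow, div_pow, mul_pow, Real.sq_sqrt hp.le, hfp]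
    field_simp
  have hc : ‖f z‖ / (√p * ‖z‖) = ‖f z‖ / ‖z‖ * (1 / √p) := by field_simp
  refine ⟨hp.trans_le hFp, ?_, ?_⟩
  · have h1 := le_norm_det_mul_sqrt hz0 hp hzp
      (fun w hw => by
        rw [hJh]; exact inner_map_eq_zero_of_isExtrOn_sphere hz0 hd (Or.inl hm) hw)
      (by rw [hJh]; exact htan)
    rw [hJh, finrank_euclideanSpace_fin, hc, ← div_le_iff₀ hsp] at h1
    calc _ ≤ (‖f z‖ / ‖z‖) ^ n * (1 / √p) ^ (n + 1) := by gcongr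
      _ = _ := by rw [mul_pow, pow_succ]; ring
      _ ≤ _ := h1
  · intro δ hδ
    calc _ ≤ ‖f z‖ / ‖z‖ * (1 / √p) * ‖δ‖ := by gcongr
      _ = _ := by rw [hc]
      _ ≤ _ := htan δ hδ

end Spirallike

theorem theorem3p4 (n : ℕ) (A B α β : ℝ) (hA : -1 ≤ A) (hAB : A < B) (hB : B ≤ 1)
    (hα : α ∈ Set.Ico (0 : ℝ) 1) (hβ : β ∈ Set.Ioo (-(Real.pi / 2)) (Real.pi / 2))
    (f : EuclideanSpace ℂ (Fin n) → EuclideanSpace ℂ (Fin n))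
    (hf : f ∈ SHat n (gAB A B) α β)
    (z : EuclideanSpace ℂ (Fin n)) (hz : z ∈ Metric.ball (0 : EuclideanSpace ℂ (Fin n)) 1)
    (hz0 : z ≠ 0) :
    (IsMaxOn (fun ξ => ‖f ξ‖) (Metric.sphere 0 ‖z‖) z → 0 < quantF₁ A B α β ‖z‖ →
      ‖(fderiv ℂ f z).det‖ ≤
          (if paramT A B α ≠ 0 then
            (1 + (A - A * α + B * α) * ‖z‖) ^ (n * (B - A) * (1 - α) / (A - A * α + B * α))
              * (1 / quantF₁ A B α β ‖z‖) ^ (((n : ℝ) + 1) / 2)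
          else
            Real.exp (n * (B - A) * (1 - α) * ‖z‖)
              * (1 / quantF₁ A B α β ‖z‖) ^ (((n : ℝ) + 1) / 2)) ∧
      ∀ δ ∈ holoTangent z,
        ‖fderiv ℂ f z δ‖ ≤
          (if paramT A B α ≠ 0 then
            (1 + (A - A * α + B * α) * ‖z‖) ^ ((B - A) * (1 - α) / (A - A * α + B * α))
              * (1 / quantF₁ A B α β ‖z‖) ^ ((1 : ℝ) / 2) * ‖δ‖
          else
            Real.exp ((B - A) * (1 - α) * ‖z‖)
              * (1 / quantF₁ A B α β ‖z‖) ^ ((1 : ℝ) / 2) * ‖δ‖)) ∧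
    (IsMinOn (fun ξ => ‖f ξ‖) (Metric.sphere 0 ‖z‖) z →
      (if paramT A B α ≠ 0 then
          (1 + (A * α - A - B * α) * ‖z‖) ^ (n * (A - B) * (1 - α) / (A * α - B * α - A))
            * quantF₂ A B α β ‖z‖ ^ (-(((n : ℝ) + 1) / 2))
        else
          Real.exp (n * (A - B) * (1 - α) * ‖z‖)
            * quantF₂ A B α β ‖z‖ ^ (-(((n : ℝ) + 1) / 2)))
        ≤ ‖(fderiv ℂ f z).det‖ ∧
      ∀ δ ∈ holoTangent z,
        (if paramT A B α ≠ 0 then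
            (1 + (A * α - A - B * α) * ‖z‖) ^ ((A - B) * (1 - α) / (A * α - B * α - A))
              * quantF₂ A B α β ‖z‖ ^ (-((1 : ℝ) / 2)) * ‖δ‖
          else
            Real.exp ((A - B) * (1 - α) * ‖z‖)
              * quantF₂ A B α β ‖z‖ ^ (-((1 : ℝ) / 2)) * ‖δ‖)
          ≤ ‖fderiv ℂ f z δ‖) := by
  have hcos : 0 < Real.cos β := Real.cos_pos_of_mem_Ioo hβ
  have hz1 := mem_ball_zero_iff.1 hz
  have hT := abs_le.1 (abs_paramT_le_one hA hAB hB hα.1 hα.2)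
  have hT1 : 0 < 1 + paramT A B α * ‖z‖ := by nlinarith [norm_nonneg z]
  have hT2 : 0 < 1 + -paramT A B α * ‖z‖ := by nlinarith [norm_nonneg z]
  -- Part (2) is stated with base `1 + (-T) ‖z‖`, so it fits `logGrowth` with parameter `-T`.
  have hbase : A * α - A - B * α = -paramT A B α := by rw [paramT]; ring
  have hden : A * α - B * α - A = -paramT A B α := by rw [paramT]; ring
  rw [hbase, hden, ← paramT]
  refine ⟨fun hm hF => ?_, fun hm => ?_⟩
  · obtain ⟨h1, h2⟩ := SHat.norm_det_le_of_isMaxOn hA hAB hB hα.1 hα.2 hcos hf hz hz0 hm hF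
    refine ⟨h1.trans_eq ?_, fun δ hδ => (h2 δ hδ).trans_eq ?_⟩
    · rw [exp_logGrowth_pow hT1, one_div_rpow_half hF, ite_mul]
      simp only [mul_assoc]
    · have h3 := one_div_rpow_half hF 0
      simp only [Nat.cast_zero, zero_add, pow_one] at h3
      rw [exp_logGrowth hT1, h3, ite_mul, ite_mul]
  · obtain ⟨hF, h1, h2⟩ := SHat.le_norm_det_of_isMinOn hA hAB hB hα.1 hα.2 hcos hf hz hz0 hm
    have hneg : ∀ x : ℝ, x * (A - B) * (1 - α) = x * -((B - A) * (1 - α)) := fun x => by ring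
    have hneg' : (A - B) * (1 - α) = -((B - A) * (1 - α)) := by ring
    refine ⟨le_of_eq_of_le ?_ h1, fun δ hδ => le_of_eq_of_le ?_ (h2 δ hδ)⟩
    · rw [exp_logGrowth_pow hT2, rpow_neg_half hF, ite_mul]
      simp only [neg_ne_zero, hneg]
    · have h3 := rpow_neg_half hF 0
      simp only [Nat.cast_zero, zero_add, pow_one] at h3
      rw [exp_logGrowth hT2, h3, ite_mul, ite_mul]
      simp only [neg_ne_zero, hneg']
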